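/- Let $\mathbb S^3=\{(z_1,z_2)\in\mathbb C^2 : |z_1|^2+|z_2|^2=1\}$, $z_j=x_j+i y_j$, with its standard (round) volume form and the standard contact form $\alpha_{\rm std}=-y_1\,dx_1+x_1\,dy_1-y_2\,dx_2+x_2\,dy_2$. For integers $p,q\ge 1$ let $S_{p,q}$ be the Seifert foliation of $\mathbb S^3$ whose leaf through $(z_1,z_2)$ is the curve $\{(z_1e^{ip\varphi},z_2e^{iq\varphi}) : \varphi\in[0,2\pi)\}$. **Proposition.** For all integers $p\ge 1$ and $q\ge 1$ there is a real-analytic vector field $X$ on $\mathbb S^3$, tangent to $\mathbb S^3$, which is nowhere zero, divergence-free with respect to the standard volume form, and Legendrian for the standard contact structure (that is, $\alpha_{\rm std}(X)=0$ everywhere), such that $S_{p,q}$ is isotopic to the foliation of $\mathbb S^3$ by the orbits of $X$: there is a smooth isotopy $\Phi_t$, $t\in[0,1]$, of diffeomorphisms of $\mathbb S^3$ with $\Phi_0=\mathrm{id}$ such that $\Phi_1$ maps the leaf of $S_{p,q}$ through each point $x$ onto the orbit of $X$ through $\Phi_1(x)$. -/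

import Mathlib

open scoped Manifold ContDiff

/-- `ℂ² ≅ ℝ⁴` with its Euclidean norm; the coordinates `0, 1, 2, 3` are `x₁, y₁, x₂, y₂`, where
`z₁ = x₁ + i y₁` and `z₂ = x₂ + i y₂`. -/
abbrev R4 : Type := EuclideanSpace ℝ (Fin 4)

/-- The unit sphere `|z₁|² + |z₂|² = 1`, with Mathlib's (real-analytic) manifold structure. -/
abbrev S3 : Type := Metric.sphere (0 : R4) 1

/-- The complex coordinate `z₁`. -/
def z₁ (x : R4) : ℂ := ⟨x 0, x 1⟩

/-- The complex coordinate `z₂`. -/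
def z₂ (x : R4) : ℂ := ⟨x 2, x 3⟩

/-! ### Vector fields on the sphere

A vector field on `S3` is written as a map `X : S3 → R4` with `X x` orthogonal to `x`. -/

/-- `X` is tangent to the sphere at every point. -/
def IsTangentField (X : S3 → R4) : Prop := ∀ x : S3, inner ℝ (x : R4) (X x) = 0

/-- `X` is real-analytic on the sphere. -/
def IsAnalyticField (X : S3 → R4) : Prop := ContMDiff (𝓡 3) 𝓘(ℝ, R4) ω X

/-- The standard contact form `-y₁ dx₁ + x₁ dy₁ - y₂ dx₂ + x₂ dy₂` at the point `x`, evaluated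
on the vector `v`. -/
def stdContactForm (x v : R4) : ℝ :=
  -x 1 * v 0 + x 0 * v 1 - x 3 * v 2 + x 2 * v 3

/-- `X` is everywhere in the kernel of the standard contact form. -/
def IsLegendrian (X : S3 → R4) : Prop := ∀ x : S3, stdContactForm x (X x) = 0

open Classical in
/-- The extension of a field from the sphere to `ℝ⁴`, constant along rays: `y ↦ X (y / ‖y‖)`
(with value `0` at the origin). -/
noncomputable def radialExtension (X : S3 → R4) (y : R4) : R4 :=
  if h : y = 0 then 0
  else X ⟨‖y‖⁻¹ • y, by
    rw [mem_sphere_zero_iff_norm, norm_smul, norm_inv, norm_norm,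
      inv_mul_cancel₀ (norm_ne_zero_iff.mpr h)]⟩

/-- The covariant derivative `v ↦ ∇_v X` at `x` for the Levi-Civita connection of the round metric,
an endomorphism of the tangent space `x^⊥`: the orthogonal projection to `x^⊥` of the Euclidean
derivative of (an extension of) `X` in the direction `v`. -/
noncomputable def covariantDerivative (X : S3 → R4) (x : S3) :
    (Submodule.span ℝ {(x : R4)})ᗮ →ₗ[ℝ] (Submodule.span ℝ {(x : R4)})ᗮ :=
  ((Submodule.span ℝ {(x : R4)})ᗮ.orthogonalProjectionOnto ∘L
    fderiv ℝ (radialExtension X) (x : R4) ∘L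
    (Submodule.span ℝ {(x : R4)})ᗮ.subtypeL).toLinearMap

/-- The divergence of a (differentiable) tangent field with respect to the standard volume form of
the sphere: the trace of `v ↦ ∇_v X`. -/
noncomputable def divergence (X : S3 → R4) (x : S3) : ℝ :=
  LinearMap.trace ℝ _ (covariantDerivative X x)

/-! ### Foliations by curves

A foliation is given by the map that sends a point to the leaf through it. -/

/-- The leaf of the Seifert foliation `S_{p,q}` through `x = (z₁, z₂)`: the curve
`φ ↦ (z₁ exp(i p φ), z₂ exp(i q φ))`, `φ ∈ [0, 2π)`. -/
def seifertLeaf (p q : ℕ) (x : S3) : Set S3 :=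
  {y | ∃ φ ∈ Set.Ico (0 : ℝ) (2 * Real.pi),
    z₁ y = z₁ x * Complex.exp (Complex.I * p * φ) ∧
    z₂ y = z₂ x * Complex.exp (Complex.I * q * φ)}

/-- The orbit of the vector field `X` through `x`: all points of the integral curve of `X`,
defined for all times, that starts at `x`. -/
def orbit (X : S3 → R4) (x : S3) : Set S3 :=
  {y | ∃ γ : ℝ → S3, γ 0 = x ∧ (∀ t : ℝ, HasDerivAt (fun s => (γ s : R4)) (X (γ t)) t) ∧
    ∃ t : ℝ, γ t = y}

/-- `Φ t`, `t ∈ [0, 1]`, is a smooth isotopy of diffeomorphisms of the sphere that starts at the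
identity. The values of `Φ` at times outside `[0, 1]` play no role. -/
def IsIsotopy (Φ : ℝ → Diffeomorph (𝓡 3) (𝓡 3) S3 S3 ∞) : Prop :=
  (∀ x : S3, Φ 0 x = x) ∧
  ContMDiffOn (𝓘(ℝ, ℝ).prod (𝓡 3)) (𝓡 3) ∞ (fun a : ℝ × S3 => Φ a.1 a.2)
    (Set.Icc (0 : ℝ) 1 ×ˢ Set.univ)

/-- Two foliations are isotopic if the time-one map of a smooth isotopy takes each leaf of the
first one onto a leaf of the second one. -/
def AreIsotopic (F G : S3 → Set S3) : Prop :=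
  ∃ Φ : ℝ → Diffeomorph (𝓡 3) (𝓡 3) S3 S3 ∞, IsIsotopy Φ ∧
    ∀ x : S3, Φ 1 '' F x = G (Φ 1 x)

/-!
Write `α` for the standard contact form. On the sphere, the contact plane at `z` consists of the
vectors `G · (-z̄₂, z̄₁)`, `G ∈ ℂ` (`frame`, `eq_frame`). Take a real function `H` on the unit
disc, put `W = 2 z₁ z₂ = a + i b` and `G = -∂H/∂b + i ∂H/∂a`, evaluated at `W`. The field
`X = G · (-z̄₂, z̄₁)` is tangent to the sphere and Legendrian. Its divergence is a multiple of
`∂(Re G)/∂a + ∂(Im G)/∂b = 0` (`divergence_field`), and it vanishes only where `dH` does. Moreover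
`W` moves along `X` with velocity `2 (|z₁|² - |z₂|²) G`, so `H ∘ W` is a first integral. It
remains to find an `H` for which the orbits of `X` are, up to isotopy, the leaves of `S_{p,q}`.

Put `k = (q - p) / (2 (p + q))`, so that `|k| < 1 / 2`. There is an explicit diffeomorphism
`twist k` of the sphere which maps every leaf of `S_{p,q}` to a curve on which
`Re (z₁ dz₂ - z₂ dz₁)` vanishes (`re_disc_mul_wronskian`, `hasDerivAt_twist`); it depends smoothly
on `k`, and `twist 0` is the identity. A rotation, which is joined to the identity through
rotations, carries `Re (z₁ dz₂ - z₂ dz₁)` to `α` (`stdContactForm_rot`). The twist with the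
parameter shrunk to `0`, followed by the rotations, is the isotopy `move`, and its time-one map
makes all leaves Legendrian.

The function `t = |z₁|² - |z₂|²` is constant on the leaves. If the image of a point under the
twist is `w`, then `t` is determined by `w`: it solves `height k t ν = |w₁|² - |w₂|²` with
`ν = (2 Im (w₁ w₂))²` (`height_twist`), and `height` is strictly increasing in `t`
(`height_injOn`). After the rotation, the two data `|w₁|² - |w₂|²` and `ν` become `Im W` and
`1 - |W|²` (`potential_rot`). Hence the solution `t` is a function of `W`, analytic by the inverse
function theorem. This function is the `potential` `H`; it is constant on the image of each leaf
(`potential_imageCurve`) and has no critical points (`symplGrad_ne_zero`).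

So the image of a leaf is a Legendrian curve with velocity `Γ · (-z̄₂, z̄₁)`, where `Γ` is tangent
to the level curves of `H` (`fderiv_potential_frameVel`) and nonzero (`frameVel_ne_zero`). As `G`
has the same properties, the velocity is a nonzero real multiple of `X`, and the curve runs
through an orbit of `X` (`orbit_eq_range`).
-/

namespace SeifertLegendrian

open ComplexConjugate

/-! ### The height function and its inverse -/

/-- The factor `1 - k t`. In the applications `t = |z₁|² - |z₂|²`. -/
def vel (k t : ℝ) : ℝ := 1 - k * t

/-- The factor `1 - k² ν`. In the applications `ν = (2 Im (w₁ w₂))²` at an image point `w`. -/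
def ecc (k ν : ℝ) : ℝ := 1 - k ^ 2 * ν

/-- If a point with `|z₁|² - |z₂|² = t` is moved by `twist k` to a point `w` of the sphere with
`(2 Im (w₁ w₂))² = ν`, then `height k t ν` is the value of `|w₁|² - |w₂|²`; see `height_twist`. -/
noncomputable def height (k t ν : ℝ) : ℝ :=
  (vel k t ^ 2 * t * (2 - k * t) + k * (2 * vel k t ^ 2 + (1 - k ^ 2))
    - k * ν * (vel k t ^ 2 + (1 - k ^ 2)) ^ 2 / ecc k ν) / (2 * vel k t)

/-- The open set of triples on which `height` is analytic and strictly increasing in `t`. It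
contains all `|k| < 1 / 2`, `|t| ≤ 1`, `0 ≤ ν ≤ 1`. -/
structure Admissible (k t ν : ℝ) : Prop where
  vel_pos : 0 < vel k t
  lt_vel : 1 - k ^ 2 < 3 * vel k t ^ 2
  ecc_pos : 0 < ecc k ν
  ecc_lt : ecc k ν < vel k t ^ 2 + (1 - k ^ 2)

/-- Multiplication by `k` turns `height` into an expression in `vel`, `ecc` and `k ^ 2` alone. -/
theorem two_mul_vel_mul_height {k t ν : ℝ} (h : Admissible k t ν) :
    2 * (k * vel k t) * height k t ν
      = 3 * vel k t ^ 2 + (1 - k ^ 2) - (vel k t ^ 2 + (1 - k ^ 2)) ^ 2 / ecc k ν := by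
  have hV := h.vel_pos.ne'
  have hE := h.ecc_pos.ne'
  have e1 : k * t = 1 - vel k t := by simp [vel]
  have e2 : k ^ 2 * ν = 1 - ecc k ν := by simp [ecc]
  have e3 : height k t ν * (2 * vel k t) * ecc k ν =
      (vel k t ^ 2 * t * (2 - k * t) + k * (2 * vel k t ^ 2 + (1 - k ^ 2))) * ecc k ν
    - k * ν * (vel k t ^ 2 + (1 - k ^ 2)) ^ 2 := by
    unfold height; field_simp
  have e4 : k * (vel k t ^ 2 * t * (2 - k * t)) = vel k t ^ 2 * (1 - vel k t) * (1 + vel k t) := by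
    rw [e1]
    linear_combination (vel k t ^ 2 * (1 + vel k t)) * e1
  field_simp
  linear_combination k * e3 + ecc k ν * e4 - (vel k t ^ 2 + (1 - k ^ 2)) ^ 2 * e2

theorem le_vel {k t : ℝ} (ht : |t| ≤ 1) : 1 - |k| ≤ vel k t := by
  have : k * t ≤ |k| := by
    calc k * t ≤ |k * t| := le_abs_self _
      _ = |k| * |t| := abs_mul _ _
      _ ≤ |k| * 1 := by gcongr
      _ = |k| := mul_one _
  unfold vel; linarith

theorem admissible_of_mem {k t ν : ℝ} (hk : |k| < 1 / 2) (ht : |t| ≤ 1) (h0 : 0 ≤ ν) (h1 : ν ≤ 1) :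
    Admissible k t ν := by
  have h := le_vel (k := k) ht
  have hk0 := abs_nonneg k
  have hsq : k ^ 2 = |k| ^ 2 := (sq_abs k).symm
  have hV : 1 / 2 < vel k t := by linarith
  have hV2 : (1 - |k|) ^ 2 ≤ vel k t ^ 2 := by gcongr; linarith
  refine ⟨by linarith, ?_, ?_, ?_⟩
  · rw [hsq]; nlinarith
  · unfold ecc; rw [hsq]; nlinarith
  · unfold ecc; rw [hsq]; nlinarith [mul_nonneg (sq_nonneg |k|) h0]

theorem contDiffAt_height {k t ν : ℝ} (h : Admissible k t ν) :
    ContDiffAt ℝ ω (fun q : ℝ × ℝ => height k q.1 q.2) (t, ν) := by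
  have hV := h.vel_pos.ne'
  have hE := h.ecc_pos.ne'
  unfold vel at hV
  unfold ecc at hE
  unfold height vel ecc
  refine ContDiffAt.div ?_ (by fun_prop) (by simpa using hV)
  refine ContDiffAt.sub (by fun_prop) ?_
  exact ContDiffAt.div (by fun_prop) (by fun_prop) (by simpa using hE)

theorem hasDerivAt_height_left {k t ν : ℝ} (h : Admissible k t ν) :
    HasDerivAt (fun s => height k s ν)
      ((3 * vel k t ^ 2 - (1 - k ^ 2)) * (vel k t ^ 2 + (1 - k ^ 2) - ecc k ν)
        / (2 * vel k t ^ 2 * ecc k ν)) t := by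
  have hV := h.vel_pos.ne'
  have hE := h.ecc_pos.ne'
  have dV : HasDerivAt (fun s => vel k s) (-k) t := by
    unfold vel; simpa using ((hasDerivAt_id t).const_mul k).const_sub 1
  have d1 := ((((dV.pow 2).mul (hasDerivAt_id t)).mul
    (((hasDerivAt_id t).const_mul k).const_sub 2)).add
    ((((dV.pow 2).const_mul 2).add_const (1 - k ^ 2)).const_mul k)).sub
    (((((dV.pow 2).add_const (1 - k ^ 2)).pow 2).const_mul (k * ν)).div_const (ecc k ν))
  have d2 := d1.div (dV.const_mul 2) (mul_ne_zero two_ne_zero hV)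
  refine (d2.congr_deriv ?_)
  have e2 : k ^ 2 * ν = 1 - ecc k ν := by simp [ecc]
  simp only [id, Pi.pow_apply, Pi.add_apply, Pi.sub_apply, Pi.mul_apply]
  field_simp
  have hV' : vel k t = 1 - k * t := rfl
  have hE' : ecc k ν = 1 - k ^ 2 * ν := rfl
  rw [hV', hE']
  push_cast
  ring

theorem hasDerivAt_height_right {k t ν : ℝ} (h : Admissible k t ν) :
    HasDerivAt (fun s => height k t s)
      (-(k * (vel k t ^ 2 + (1 - k ^ 2)) ^ 2 / (2 * vel k t * ecc k ν ^ 2))) ν := by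
  have hV := h.vel_pos.ne'
  have hE := h.ecc_pos.ne'
  have dE : HasDerivAt (fun s => ecc k s) (-k ^ 2) ν := by
    unfold ecc; simpa using ((hasDerivAt_id ν).const_mul (k ^ 2)).const_sub 1
  have d1 := (((((hasDerivAt_id ν).const_mul k).mul_const
    ((vel k t ^ 2 + (1 - k ^ 2)) ^ 2)).div dE hE).const_sub
    (vel k t ^ 2 * t * (2 - k * t) + k * (2 * vel k t ^ 2 + (1 - k ^ 2)))).div_const (2 * vel k t)
  refine (d1.congr_deriv ?_)
  have hE' : ecc k ν = 1 - k ^ 2 * ν := rfl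
  simp only [id]
  field_simp
  rw [hE']
  ring

theorem height_injOn {k t₁ t₂ ν : ℝ} (h₁ : Admissible k t₁ ν) (h₂ : Admissible k t₂ ν)
    (h : height k t₁ ν = height k t₂ ν) : t₁ = t₂ := by
  wlog hlt : t₁ < t₂ generalizing t₁ t₂
  · rcases lt_trichotomy t₁ t₂ with h' | h' | h'
    · exact this h₁ h₂ h h'
    · exact h'
    · exact (this h₂ h₁ h.symm h').symm
  exfalso
  -- For fixed `ν`, admissibility is a lower bound on `vel`, which is affine in `t`.
  have adm : ∀ s ∈ Set.Icc t₁ t₂, Admissible k s ν := by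
    intro s hs
    have : min (vel k t₁) (vel k t₂) ≤ vel k s := by
      unfold vel
      rcases le_total 0 k with hk | hk
      · exact (min_le_right _ _).trans (by nlinarith [hs.1, hs.2])
      · exact (min_le_left _ _).trans (by nlinarith [hs.1, hs.2])
    rcases min_choice (vel k t₁) (vel k t₂) with hm | hm
    · rw [hm] at this
      exact ⟨h₁.vel_pos.trans_le this, by nlinarith [h₁.lt_vel, h₁.vel_pos], h₁.ecc_pos,
        by nlinarith [h₁.ecc_lt, h₁.vel_pos]⟩
    · rw [hm] at this
      exact ⟨h₂.vel_pos.trans_le this, by nlinarith [h₂.lt_vel, h₂.vel_pos], h₁.ecc_pos,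
        by nlinarith [h₂.ecc_lt, h₂.vel_pos]⟩
  have hmono : StrictMonoOn (fun s => height k s ν) (Set.Icc t₁ t₂) := by
    refine strictMonoOn_of_deriv_pos (convex_Icc _ _)
      (fun s hs => (hasDerivAt_height_left (adm s hs)).continuousAt.continuousWithinAt) ?_
    intro s hs
    have ha := adm s (interior_subset hs)
    rw [(hasDerivAt_height_left ha).deriv]
    have := ha.vel_pos
    have := ha.ecc_pos
    have := ha.lt_vel
    have := ha.ecc_lt
    exact div_pos (mul_pos (by linarith) (by linarith)) (by positivity)
  exact (hmono ⟨le_rfl, hlt.le⟩ ⟨hlt.le, le_rfl⟩ hlt).ne h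

/-- The intermediate value theorem applies because, with `ν = 1 - r²`, the differences
`height k 1 ν - r` and `-(height k (-1) ν + r)` are nonnegative: up to a positive factor, they are
`1 - r` times a square. -/
theorem exists_height_eq {k h ν : ℝ} (hk : |k| < 1 / 2) (h0 : 0 ≤ ν) (h1 : h ^ 2 ≤ 1 - ν) :
    ∃ t ∈ Set.Icc (-1 : ℝ) 1, height k t ν = h := by
  have hν : ν ≤ 1 := by nlinarith [sq_nonneg h]
  have hadm : ∀ t ∈ Set.Icc (-1 : ℝ) 1, Admissible k t ν := fun t ht =>
    admissible_of_mem hk (abs_le.2 ht) h0 hν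
  have hc : ContinuousOn (fun s => height k s ν) (Set.Icc (-1) 1) := fun s hs =>
    (hasDerivAt_height_left (hadm s hs)).continuousAt.continuousWithinAt
  obtain ⟨r, hr0, hr⟩ : ∃ r, 0 ≤ r ∧ ν = 1 - r ^ 2 :=
    ⟨√(1 - ν), Real.sqrt_nonneg _, by rw [Real.sq_sqrt (by linarith)]; ring⟩
  have hr1 : r ≤ 1 := by nlinarith
  have hhr : |h| ≤ r := abs_le_of_sq_le_sq (by linarith) hr0
  have hk2 := abs_lt.1 hk
  have e1 : height k 1 ν - r = (1 - r) * (1 - k - k * r) ^ 2 / ecc k ν := by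
    have ha := hadm 1 (by simp)
    have hV := ha.vel_pos.ne'
    have hE := ha.ecc_pos.ne'
    unfold height
    field_simp
    have hV' : vel k 1 = 1 - k * 1 := rfl
    have hE' : ecc k ν = 1 - k ^ 2 * ν := rfl
    rw [hV', hE', hr]
    ring
  have e2 : height k (-1) ν + r = -((1 - r) * (1 + k + k * r) ^ 2 / ecc k ν) := by
    have ha := hadm (-1) (by simp)
    have hV := ha.vel_pos.ne'
    have hE := ha.ecc_pos.ne'
    unfold height
    field_simp
    have hV' : vel k (-1) = 1 - k * (-1) := rfl
    have hE' : ecc k ν = 1 - k ^ 2 * ν := rfl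
    rw [hV', hE', hr]
    ring
  have hE := (hadm 1 (by simp)).ecc_pos
  have p1 : 0 ≤ (1 - r) * (1 - k - k * r) ^ 2 / ecc k ν :=
    div_nonneg (mul_nonneg (by linarith) (sq_nonneg _)) hE.le
  have p2 : 0 ≤ (1 - r) * (1 + k + k * r) ^ 2 / ecc k ν :=
    div_nonneg (mul_nonneg (by linarith) (sq_nonneg _)) hE.le
  have := abs_le.1 hhr
  have hmem : h ∈ Set.Icc (height k (-1) ν) (height k 1 ν) := ⟨by linarith, by linarith⟩
  obtain ⟨t, ht, e⟩ := intermediate_value_Icc (by norm_num) hc hmem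
  exact ⟨t, ht, e⟩

open Classical in
/-- The inverse of `t ↦ height k t ν` on admissible triples: the solution `t` of
`height k t ν = h`, with the value `0` if there is none. -/
noncomputable def level (k h ν : ℝ) : ℝ :=
  if H : ∃ t, Admissible k t ν ∧ height k t ν = h then H.choose else 0

theorem level_height {k t ν : ℝ} (h : Admissible k t ν) : level k (height k t ν) ν = t := by
  have H : ∃ s, Admissible k s ν ∧ height k s ν = height k t ν := ⟨t, h, rfl⟩
  rw [level, dif_pos H]
  exact height_injOn H.choose_spec.1 h H.choose_spec.2

theorem eventually_admissible {k t ν : ℝ} (h : Admissible k t ν) :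
    ∀ᶠ q : ℝ × ℝ in nhds (t, ν), Admissible k q.1 q.2 := by
  have hV : Continuous fun q : ℝ × ℝ => vel k q.1 := by unfold vel; fun_prop
  have hE : Continuous fun q : ℝ × ℝ => ecc k q.2 := by unfold ecc; fun_prop
  filter_upwards [continuousAt_const.eventually_lt hV.continuousAt h.vel_pos,
    continuousAt_const.eventually_lt ((hV.pow 2).const_mul 3).continuousAt h.lt_vel,
    continuousAt_const.eventually_lt hE.continuousAt h.ecc_pos,
    hE.continuousAt.eventually_lt ((hV.pow 2).add_const (1 - k ^ 2)).continuousAt h.ecc_lt]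
    with q a b c d
  exact ⟨a, b, c, d⟩

/-- The inverse function theorem for `(t, ν) ↦ (height k t ν, ν)`. -/
theorem contDiffAt_level {k t ν : ℝ} (h : Admissible k t ν) :
    ContDiffAt ℝ ω (fun q : ℝ × ℝ => level k q.1 q.2) (height k t ν, ν) ∧
      ∀ᶠ q : ℝ × ℝ in nhds (height k t ν, ν), height k (level k q.1 q.2) q.2 = q.1 := by
  have hg := contDiffAt_height h
  set f' := fderiv ℝ (fun q : ℝ × ℝ => height k q.1 q.2) (t, ν) with hf'
  have hgd : HasFDerivAt (fun q : ℝ × ℝ => height k q.1 q.2) f' (t, ν) :=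
    (hg.differentiableAt (by simp)).hasFDerivAt
  have ha : f' (1, 0) ≠ 0 := by
    have h1 : HasDerivAt (fun s => height k s ν) (f' (1, 0)) t :=
      HasFDerivAt.comp_hasDerivAt (f := fun s => (s, ν)) t hgd
        ((hasDerivAt_id t).prodMk (hasDerivAt_const t ν))
    rw [h1.unique (hasDerivAt_height_left h)]
    have := h.vel_pos
    have := h.ecc_pos
    have := h.lt_vel
    have := h.ecc_lt
    exact (div_pos (mul_pos (by linarith) (by linarith)) (by positivity)).ne'
  have hlin : ∀ q : ℝ × ℝ, f' q = q.1 * f' (1, 0) + q.2 * f' (0, 1) := by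
    intro q
    have : q = q.1 • ((1, 0) : ℝ × ℝ) + q.2 • ((0, 1) : ℝ × ℝ) := by ext <;> simp
    conv_lhs => rw [this]
    rw [map_add, map_smul, map_smul, smul_eq_mul, smul_eq_mul]
  let A : (ℝ × ℝ) ≃L[ℝ] (ℝ × ℝ) := ContinuousLinearEquiv.equivOfInverse
    (f'.prod (ContinuousLinearMap.snd ℝ ℝ ℝ))
    (((f' (1, 0))⁻¹ • (ContinuousLinearMap.fst ℝ ℝ ℝ
      - f' (0, 1) • ContinuousLinearMap.snd ℝ ℝ ℝ)).prod (ContinuousLinearMap.snd ℝ ℝ ℝ))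
    (by intro q
        ext
        · simp [hlin q]; field_simp; ring
        · simp)
    (by intro q
        ext
        · have := hlin ((f' (1, 0))⁻¹ * (q.1 - f' (0, 1) * q.2), q.2)
          simp only [ContinuousLinearMap.prod_apply, smul_apply,
            sub_apply, ContinuousLinearMap.coe_fst',
            ContinuousLinearMap.coe_snd', smul_eq_mul, this]
          field_simp; ring
        · simp)
  have hΘ : ContDiffAt ℝ ω (fun q : ℝ × ℝ => (height k q.1 q.2, q.2)) (t, ν) :=
    hg.prodMk contDiffAt_snd
  have hΘ' : HasFDerivAt (fun q : ℝ × ℝ => (height k q.1 q.2, q.2)) (A : (ℝ × ℝ) →L[ℝ] (ℝ × ℝ))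
      (t, ν) := hgd.prodMk hasFDerivAt_snd
  have hinv := hΘ.to_localInverse hΘ' (by simp)
  have h0 := hΘ.localInverse_apply_image hΘ' (by simp)
  have hstrict := hΘ.hasStrictFDerivAt' hΘ' (by simp)
  have hright : ∀ᶠ y in nhds ((height k t ν, ν) : ℝ × ℝ),
      (fun q : ℝ × ℝ => (height k q.1 q.2, q.2)) (hΘ.localInverse hΘ' (by simp) y) = y :=
    hstrict.eventually_right_inverse
  have hadm : ∀ᶠ y in nhds ((height k t ν, ν) : ℝ × ℝ),
      Admissible k (hΘ.localInverse hΘ' (by simp) y).1 (hΘ.localInverse hΘ' (by simp) y).2 := by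
    have hc := hinv.continuousAt
    have := hc.tendsto
    rw [h0] at this
    exact this.eventually (eventually_admissible h)
  have hlevel : ∀ᶠ y in nhds ((height k t ν, ν) : ℝ × ℝ),
      level k y.1 y.2 = (hΘ.localInverse hΘ' (by simp) y).1 ∧
        height k (level k y.1 y.2) y.2 = y.1 := by
    filter_upwards [hright, hadm] with y h1 h2
    obtain ⟨h3, h4⟩ := Prod.ext_iff.1 h1
    simp only at h3 h4
    rw [h4] at h2 h3
    have h5 : level k y.1 y.2 = (hΘ.localInverse hΘ' (by simp) y).1 := by
      conv_lhs => rw [← h3]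
      exact level_height h2
    exact ⟨h5, by rw [h5, h3]⟩
  exact ⟨(contDiffAt_fst.comp _ hinv).congr_of_eventuallyEq (hlevel.mono fun y hy => hy.1),
    hlevel.mono fun y hy => hy.2⟩

/-! ### Complex coordinates on `R4` -/

/-- The point of `R4` with complex coordinates `(a, b)`. -/
def ofPair (a b : ℂ) : R4 := !₂[a.re, a.im, b.re, b.im]

@[simp] theorem z₁_ofPair (a b : ℂ) : z₁ (ofPair a b) = a := by
  apply Complex.ext <;> simp [z₁, ofPair]

@[simp] theorem z₂_ofPair (a b : ℂ) : z₂ (ofPair a b) = b := by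
  apply Complex.ext <;> simp [z₂, ofPair]

@[simp] theorem ofPair_z (x : R4) : ofPair (z₁ x) (z₂ x) = x := by
  ext i; fin_cases i <;> simp [ofPair, z₁, z₂]

theorem ext_z {x y : R4} (h₁ : z₁ x = z₁ y) (h₂ : z₂ x = z₂ y) : x = y := by
  rw [← ofPair_z x, ← ofPair_z y, h₁, h₂]

theorem inner_eq_re (x y : R4) :
    inner ℝ x y = (conj (z₁ x) * z₁ y + conj (z₂ x) * z₂ y).re := by
  simp [PiLp.inner_apply, Fin.sum_univ_four, z₁, z₂]
  ring

theorem norm_sq_eq (x : R4) : ‖x‖ ^ 2 = Complex.normSq (z₁ x) + Complex.normSq (z₂ x) := by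
  rw [EuclideanSpace.real_norm_sq_eq]
  simp [Fin.sum_univ_four, z₁, z₂, Complex.normSq_apply]
  ring

theorem stdContactForm_eq (x v : R4) :
    stdContactForm x v = (conj (z₁ x) * z₁ v + conj (z₂ x) * z₂ v).im := by
  simp [stdContactForm, z₁, z₂]
  ring

theorem normSq_add_normSq (x : S3) :
    Complex.normSq (z₁ x) + Complex.normSq (z₂ x) = 1 := by
  rw [← norm_sq_eq, norm_eq_of_mem_sphere x]; norm_num

/-- `z₁` as a continuous linear map. -/
noncomputable def z₁L : R4 →L[ℝ] ℂ := LinearMap.toContinuousLinearMap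
  { toFun := z₁
    map_add' := fun x y => by apply Complex.ext <;> simp [z₁]
    map_smul' := fun c x => by apply Complex.ext <;> simp [z₁] }

/-- `z₂` as a continuous linear map. -/
noncomputable def z₂L : R4 →L[ℝ] ℂ := LinearMap.toContinuousLinearMap
  { toFun := z₂
    map_add' := fun x y => by apply Complex.ext <;> simp [z₂]
    map_smul' := fun c x => by apply Complex.ext <;> simp [z₂] }

/-- `ofPair` as a continuous linear map. -/
noncomputable def ofPairL : ℂ × ℂ →L[ℝ] R4 := LinearMap.toContinuousLinearMap
  { toFun := fun p => ofPair p.1 p.2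
    map_add' := fun x y => by ext i; fin_cases i <;> simp [ofPair]
    map_smul' := fun c x => by ext i; fin_cases i <;> simp [ofPair] }

@[simp] theorem z₁L_apply (x : R4) : z₁L x = z₁ x := rfl
@[simp] theorem z₂L_apply (x : R4) : z₂L x = z₂ x := rfl
@[simp] theorem ofPairL_apply (p : ℂ × ℂ) : ofPairL p = ofPair p.1 p.2 := rfl

@[fun_prop] theorem contDiff_z₁ {n : WithTop ℕ∞} : ContDiff ℝ n z₁ := z₁L.contDiff
@[fun_prop] theorem contDiff_z₂ {n : WithTop ℕ∞} : ContDiff ℝ n z₂ := z₂L.contDiff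
@[fun_prop] theorem continuous_z₁ : Continuous z₁ := z₁L.continuous
@[fun_prop] theorem continuous_z₂ : Continuous z₂ := z₂L.continuous
@[fun_prop] theorem contDiff_conj {n : WithTop ℕ∞} : ContDiff ℝ n (conj : ℂ → ℂ) :=
  Complex.conjCLE.contDiff
@[fun_prop] theorem contDiff_re {n : WithTop ℕ∞} : ContDiff ℝ n Complex.re :=
  Complex.reCLM.contDiff
@[fun_prop] theorem contDiff_im {n : WithTop ℕ∞} : ContDiff ℝ n Complex.im :=
  Complex.imCLM.contDiff
@[fun_prop] theorem contDiff_ofReal {n : WithTop ℕ∞} : ContDiff ℝ n (Complex.ofReal : ℝ → ℂ) :=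
  Complex.ofRealCLM.contDiff
@[fun_prop] theorem contDiff_normSq {n : WithTop ℕ∞} : ContDiff ℝ n (fun z => Complex.normSq z) := by
  simp only [Complex.normSq_apply]; fun_prop

theorem _root_.ContDiffAt.ofPair {E : Type*} [NormedAddCommGroup E] [NormedSpace ℝ E]
    {n : WithTop ℕ∞} {f g : E → ℂ} {x : E} (hf : ContDiffAt ℝ n f x) (hg : ContDiffAt ℝ n g x) :
    ContDiffAt ℝ n (fun y => ofPair (f y) (g y)) x :=
  ofPairL.contDiff.contDiffAt.comp x (hf.prodMk hg)

/-! ### The potential on the unit disc -/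

/-- The function on the unit disc whose composition with `W = 2 z₁ z₂` is the first integral of the
field. It recovers `|z₁|² - |z₂|²` on the original leaf from a point of its image; see
`potential_imageCurve`. -/
noncomputable def potential (k : ℝ) (W : ℂ) : ℝ := level k W.im (1 - W.re ^ 2 - W.im ^ 2)

theorem exists_level {k : ℝ} {W : ℂ} (hk : |k| < 1 / 2) (hW : Complex.normSq W ≤ 1) :
    ∃ t, |t| ≤ 1 ∧ Admissible k t (1 - W.re ^ 2 - W.im ^ 2) ∧
      height k t (1 - W.re ^ 2 - W.im ^ 2) = W.im ∧ potential k W = t := by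
  rw [Complex.normSq_apply] at hW
  obtain ⟨t, ht, e⟩ := exists_height_eq (h := W.im) (ν := 1 - W.re ^ 2 - W.im ^ 2) hk
    (by nlinarith) (by nlinarith [sq_nonneg W.re])
  have ha := admissible_of_mem (t := t) (ν := 1 - W.re ^ 2 - W.im ^ 2) hk (abs_le.2 ht)
    (by nlinarith) (by nlinarith [sq_nonneg W.re, sq_nonneg W.im])
  refine ⟨t, abs_le.2 ht, ha, e, ?_⟩
  have := level_height ha
  rwa [e] at this

theorem contDiffAt_potential {k : ℝ} {W : ℂ} (hk : |k| < 1 / 2) (hW : Complex.normSq W ≤ 1) :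
    ContDiffAt ℝ ω (potential k) W := by
  obtain ⟨t, -, ha, e, -⟩ := exists_level hk hW
  have h1 := (contDiffAt_level ha).1
  rw [e] at h1
  have h2 : ContDiffAt ℝ ω (fun W : ℂ => (W.im, 1 - W.re ^ 2 - W.im ^ 2)) W := by fun_prop
  exact h1.comp W h2

theorem eventually_height_potential {k : ℝ} {W : ℂ} (hk : |k| < 1 / 2)
    (hW : Complex.normSq W ≤ 1) :
    ∀ᶠ W' in nhds W, height k (potential k W') (1 - W'.re ^ 2 - W'.im ^ 2) = W'.im := by
  obtain ⟨t, -, ha, e, -⟩ := exists_level hk hW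
  have h1 := (contDiffAt_level ha).2
  rw [e] at h1
  have h2 : Continuous (fun W : ℂ => (W.im, 1 - W.re ^ 2 - W.im ^ 2)) := by fun_prop
  exact (h2.tendsto W).eventually h1

/-- `-∂H/∂b + i ∂H/∂a`, where `H = potential k` and `W = a + i b`: the gradient of the potential
turned by a quarter. It is tangent to the level curves of the potential. -/
noncomputable def symplGrad (k : ℝ) (W : ℂ) : ℂ :=
  ⟨-fderiv ℝ (potential k) W Complex.I, fderiv ℝ (potential k) W 1⟩

theorem contDiffAt_symplGrad {k : ℝ} {W : ℂ} (hk : |k| < 1 / 2) (hW : Complex.normSq W ≤ 1) :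
    ContDiffAt ℝ ω (symplGrad k) W := by
  have h1 : ContDiffAt ℝ ω (fderiv ℝ (potential k)) W :=
    (contDiffAt_potential hk hW).fderiv_right (by simp)
  have e : symplGrad k = fun W => -((fderiv ℝ (potential k) W Complex.I : ℝ) : ℂ)
      + Complex.I * (fderiv ℝ (potential k) W 1 : ℝ) := by
    ext W; apply Complex.ext <;> simp [symplGrad]
  rw [e]
  have h2 : ContDiffAt ℝ ω (fun W => fderiv ℝ (potential k) W Complex.I) W :=
    h1.clm_apply contDiffAt_const
  have h3 : ContDiffAt ℝ ω (fun W => fderiv ℝ (potential k) W 1) W :=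
    h1.clm_apply contDiffAt_const
  exact (contDiff_ofReal.contDiffAt.comp W h2).neg.add
    (contDiffAt_const.mul (contDiff_ofReal.contDiffAt.comp W h3))

/-- At a critical point of the potential, `W.re = 0` and the equation `h` holds with `b = W.im`.
In terms of `V = vel k t`, `y = k b` and `c = 1 - k²`, elimination of `(V² + c)²` from `h` and `hb`
gives `(V - y) (c - 3 V y) = 0`. The first factor is positive by admissibility; if the second one
vanishes, then `hb` gives `c = 3 V²`, which admissibility forbids. -/
theorem not_critical {k t b : ℝ} (ha : Admissible k t (1 - b ^ 2))
    (hb : height k t (1 - b ^ 2) = b)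
    (h : 2 * b * (k * (vel k t ^ 2 + (1 - k ^ 2)) ^ 2 / (2 * vel k t * ecc k (1 - b ^ 2) ^ 2)) = 1) :
    False := by
  have h2 := two_mul_vel_mul_height ha
  rw [hb] at h2
  obtain ⟨hV, hlt, hE, hE'⟩ := ha
  generalize vel k t = V at *
  have e1 : ecc k (1 - b ^ 2) = 1 - k ^ 2 + (k * b) ^ 2 := by unfold ecc; ring
  rw [e1] at h h2 hE hE'
  obtain ⟨c, hc⟩ : ∃ c, c = 1 - k ^ 2 := ⟨_, rfl⟩
  obtain ⟨y, hy⟩ : ∃ y, y = k * b := ⟨_, rfl⟩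
  rw [← hc, ← hy] at h h2 hE hE'
  rw [← hc] at hlt
  have hE0 := hE.ne'
  have hV0 := hV.ne'
  field_simp at h h2
  have h2' : (V ^ 2 + c) ^ 2 = (c + y ^ 2) * (3 * V ^ 2 + c - 2 * V * y) := by
    rw [hy]; rw [hy] at h2; linear_combination h2
  have h3 : (V - y) * (c - 3 * V * y) = 0 := by
    have : (c + y ^ 2) * ((V - y) * (c - 3 * V * y)) = 0 := by
      have h' : y * (V ^ 2 + c) ^ 2 = V * (c + y ^ 2) ^ 2 := by
        rw [hy]; rw [hy] at h; linear_combination h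
      rw [h2'] at h'
      linear_combination -h'
    exact (mul_eq_zero.1 this).resolve_left hE0
  have hVy : V - y ≠ 0 := by
    intro h0
    have : V = y := by linarith
    rw [this] at hE'
    linarith
  have h4 := (mul_eq_zero.1 h3).resolve_left hVy
  have h5 : (V - y) ^ 2 * (V ^ 2 + 2 * V * y - c) = 0 := by linear_combination h2'
  have h6 := (mul_eq_zero.1 h5).resolve_left (pow_ne_zero 2 hVy)
  linarith

/-- Differentiating `height k (potential k W) (1 - |W|²) = W.im` at a critical point of the
potential leaves only the derivative of `height` in `ν`, and leads to `not_critical`. -/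
theorem symplGrad_ne_zero {k : ℝ} {W : ℂ} (hk : |k| < 1 / 2) (hW : Complex.normSq W ≤ 1) :
    symplGrad k W ≠ 0 := by
  intro h0
  obtain ⟨t, -, ha, e, ht⟩ := exists_level hk hW
  have hD1 : fderiv ℝ (potential k) W 1 = 0 := by simpa [symplGrad] using congrArg Complex.im h0
  have hDI : fderiv ℝ (potential k) W Complex.I = 0 := by
    simpa [symplGrad] using congrArg Complex.re h0
  have hp : HasFDerivAt (potential k) (fderiv ℝ (potential k) W) W :=
    ((contDiffAt_potential hk hW).differentiableAt (by simp)).hasFDerivAt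
  have hg : HasFDerivAt (fun q : ℝ × ℝ => height k q.1 q.2)
      (fderiv ℝ (fun q : ℝ × ℝ => height k q.1 q.2) (t, 1 - W.re ^ 2 - W.im ^ 2))
      (t, 1 - W.re ^ 2 - W.im ^ 2) :=
    ((contDiffAt_height ha).differentiableAt (by simp)).hasFDerivAt
  set g' := fderiv ℝ (fun q : ℝ × ℝ => height k q.1 q.2) (t, 1 - W.re ^ 2 - W.im ^ 2)
  have hν := HasFDerivAt.comp_hasDerivAt (f := fun s => (t, s)) _ hg
    ((hasDerivAt_const _ t).prodMk (hasDerivAt_id _))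
  have hν' := hν.unique (hasDerivAt_height_right ha)
  have key : ∀ v : ℂ, fderiv ℝ (potential k) W v = 0 →
      (-(2 * W.re * v.re) - 2 * W.im * v.im) * g' (0, 1) = v.im := by
    intro v hv
    have hline : HasDerivAt (fun s : ℝ => W + s • v) v 0 := by
      simpa using ((hasDerivAt_id (0 : ℝ)).smul_const v).const_add W
    have hre : HasDerivAt (fun s : ℝ => (W + s • v).re) v.re 0 := by
      simpa using ((hasDerivAt_id (0 : ℝ)).mul_const v.re).const_add W.re
    have him : HasDerivAt (fun s : ℝ => (W + s • v).im) v.im 0 := by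
      simpa using ((hasDerivAt_id (0 : ℝ)).mul_const v.im).const_add W.im
    have h1 : HasDerivAt (fun s : ℝ => potential k (W + s • v)) 0 0 := by
      have := HasFDerivAt.comp_hasDerivAt (f := fun s : ℝ => W + s • v) 0
        (by simpa using hp) hline
      rwa [hv] at this
    have h2 := ((hre.pow 2).const_sub 1).sub (him.pow 2)
    have h3 := HasFDerivAt.comp_hasDerivAt
      (f := fun s : ℝ => (potential k (W + s • v),
        1 - (W + s • v).re ^ 2 - (W + s • v).im ^ 2)) 0
      (by simpa [ht] using hg) (h1.prodMk h2)
    have hev : ∀ᶠ s : ℝ in nhds 0, height k (potential k (W + s • v))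
        (1 - (W + s • v).re ^ 2 - (W + s • v).im ^ 2) = (W + s • v).im := by
      have hc : Filter.Tendsto (fun s : ℝ => W + s • v) (nhds 0) (nhds W) := by
        simpa using hline.continuousAt.tendsto
      exact hc.eventually (eventually_height_potential hk hW)
    have h4 := h3.unique (him.congr_of_eventuallyEq hev)
    refine Eq.trans ?_ h4
    have : ∀ r : ℝ, g' (0, r) = r * g' (0, 1) := by
      intro r
      rw [← smul_eq_mul, ← map_smul]
      simp
    rw [this (_ - _)]
    simp only [zero_smul, add_zero]
    push_cast
    ring
  have k1 := key 1 hD1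
  have k2 := key Complex.I hDI
  simp at k1 k2
  have hre : W.re = 0 := by
    rcases k1 with h | h
    · exact h
    · rw [h] at k2; simp at k2
  rw [hν'] at k2
  rw [hre] at ha e k2
  simp only [ne_eq, OfNat.ofNat_ne_zero, not_false_eq_true, zero_pow, sub_zero] at ha e k2
  exact not_critical ha e (by linarith)

/-! ### The Legendrian field -/

theorem normSq_two_mul_le (x : S3) : Complex.normSq (2 * (z₁ x * z₂ x)) ≤ 1 := by
  have h := normSq_add_normSq x
  simp only [map_mul]
  rw [show Complex.normSq 2 = 4 by norm_num [Complex.normSq_apply]]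
  nlinarith [sq_nonneg (Complex.normSq (z₁ x) - Complex.normSq (z₂ x))]

/-- The vector `G · (-z̄₂, z̄₁)` at the point `y`. On the sphere these vectors, `G ∈ ℂ`, are
exactly the contact plane; see `eq_frame`. -/
noncomputable def frame (y : R4) (G : ℂ) : R4 := ofPair (-(conj (z₂ y)) * G) (conj (z₁ y) * G)

theorem inner_frame (y : R4) (G : ℂ) : inner ℝ y (frame y G) = 0 := by
  rw [inner_eq_re]; simp [frame]; ring

theorem stdContactForm_frame (y : R4) (G : ℂ) : stdContactForm y (frame y G) = 0 := by
  rw [stdContactForm_eq]; simp [frame]; ring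

theorem norm_sq_frame (y : R4) (G : ℂ) : ‖frame y G‖ ^ 2 = ‖y‖ ^ 2 * Complex.normSq G := by
  rw [norm_sq_eq, norm_sq_eq]; simp [frame]; ring

theorem eq_frame {y : S3} {v : R4} (h₁ : inner ℝ (y : R4) v = 0) (h₂ : stdContactForm y v = 0) :
    v = frame y (z₁ y * z₂ v - z₂ y * z₁ v) := by
  have h0 : conj (z₁ y) * z₁ v + conj (z₂ y) * z₂ v = 0 := by
    apply Complex.ext
    · rw [← inner_eq_re, h₁]; simp
    · rw [← stdContactForm_eq, h₂]; simp
  have hn : z₁ y * conj (z₁ y) + z₂ y * conj (z₂ y) = 1 := by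
    rw [Complex.mul_conj, Complex.mul_conj, ← Complex.ofReal_add, normSq_add_normSq]; simp
  apply ext_z
  · simp only [frame, z₁_ofPair]
    linear_combination (-z₁ v) * hn + z₁ y * h0
  · simp only [frame, z₂_ofPair]
    linear_combination (-z₂ v) * hn + z₂ y * h0

/-- The vector field `G · (-z̄₂, z̄₁)` on `R4`, where `G` is the turned gradient of the potential at
`W = 2 z₁ z₂`. Only its values near the sphere matter, where the potential is analytic. -/
noncomputable def ambientField (k : ℝ) (y : R4) : R4 :=
  frame y (symplGrad k (2 * (z₁ y * z₂ y)))

/-- The restriction of `ambientField` to the sphere. -/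
noncomputable def field (k : ℝ) (x : S3) : R4 := ambientField k x

theorem contDiffAt_ambientField {k : ℝ} (hk : |k| < 1 / 2) (x : S3) :
    ContDiffAt ℝ ω (ambientField k) x := by
  have hG : ContDiffAt ℝ ω (fun y : R4 => symplGrad k (2 * (z₁ y * z₂ y))) x :=
    (contDiffAt_symplGrad hk (normSq_two_mul_le x)).comp (x : R4)
      (f := fun y : R4 => 2 * (z₁ y * z₂ y)) (by fun_prop)
  exact ContDiffAt.ofPair (ContDiffAt.mul (by fun_prop) hG) (ContDiffAt.mul (by fun_prop) hG)

theorem isTangentField_field (k : ℝ) : IsTangentField (field k) := fun x => inner_frame x _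

theorem isLegendrian_field (k : ℝ) : IsLegendrian (field k) := fun x => stdContactForm_frame x _

theorem field_ne_zero {k : ℝ} (hk : |k| < 1 / 2) (x : S3) : field k x ≠ 0 := by
  intro h
  have h1 := norm_sq_frame x (symplGrad k (2 * (z₁ x * z₂ x)))
  have h2 : frame x (symplGrad k (2 * (z₁ x * z₂ x))) = 0 := h
  rw [h2, norm_eq_of_mem_sphere x] at h1
  simp at h1
  exact symplGrad_ne_zero hk (normSq_two_mul_le x) (Complex.normSq_eq_zero.1 h1.symm)

instance : Fact (Module.finrank ℝ R4 = 3 + 1) := ⟨finrank_euclideanSpace_fin⟩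

theorem isAnalyticField_field {k : ℝ} (hk : |k| < 1 / 2) : IsAnalyticField (field k) := by
  intro x
  exact (contDiffAt_ambientField hk x).contMDiffAt.comp x (contMDiff_coe_sphere x)

/-! ### Divergence of a tangent field with an ambient extension -/

theorem hasFDerivAt_norm_of_sphere (x : S3) :
    HasFDerivAt (fun y : R4 => ‖y‖) (innerSL ℝ (x : R4)) (x : R4) := by
  have h1 := (hasStrictFDerivAt_norm_sq (x : R4)).hasFDerivAt
  have h2 := h1.sqrt (by simp)
  simp only [Real.sqrt_sq (norm_nonneg _)] at h2
  refine h2.congr_fderiv ?_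
  ext v; simp

/-- The divergence of a field on the sphere is the Euclidean divergence of any extension that is
orthogonal to the radial direction, off the sphere too. -/
theorem divergence_eq_trace {X : S3 → R4} {F : R4 → R4} {x : S3}
    (hF : DifferentiableAt ℝ F x) (hX : ∀ y : S3, X y = F y) (hr : ∀ y : R4, inner ℝ y (F y) = 0) :
    divergence X x = ∑ i, (fderiv ℝ F x (EuclideanSpace.single i 1)) i := by
  classical
  set D := fderiv ℝ F x with hD
  have hx : (x : R4) ≠ 0 := ne_zero_of_mem_unit_sphere x
  have hn : ‖(x : R4)‖ = 1 := norm_eq_of_mem_sphere x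
  have hFd : HasFDerivAt F D x := hF.hasFDerivAt
  have hnorm := hasFDerivAt_norm_of_sphere x
  have hunit : HasFDerivAt (fun y : R4 => ‖y‖⁻¹ • y)
      (ContinuousLinearMap.id ℝ R4 - (innerSL ℝ (x : R4)).smulRight (x : R4)) (x : R4) := by
    have h1 := (hasDerivAt_inv (by simp : ‖(x : R4)‖ ≠ 0)).comp_hasFDerivAt (x : R4) hnorm
    have h2 := h1.smul (hasFDerivAt_id (x : R4))
    refine h2.congr_fderiv ?_
    ext v i
    simp
    ring
  have hunit' : HasFDerivAt F D ((fun y : R4 => ‖y‖⁻¹ • y) (x : R4)) := by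
    simpa using hFd
  have hrad : HasFDerivAt (radialExtension X)
      (D.comp (ContinuousLinearMap.id ℝ R4 - (innerSL ℝ (x : R4)).smulRight (x : R4))) (x : R4) := by
    refine (HasFDerivAt.comp (f := fun y : R4 => ‖y‖⁻¹ • y) (x : R4)
      hunit' hunit).congr_of_eventuallyEq ?_
    filter_upwards [isOpen_ne.mem_nhds hx] with y hy
    rw [radialExtension, dif_neg hy, hX]; rfl
  have hDx : inner ℝ (x : R4) (D x) = 0 := by
    have hline : HasDerivAt (fun s : ℝ => s • (x : R4)) (x : R4) 1 := by
      simpa using (hasDerivAt_id (1 : ℝ)).smul_const (x : R4)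
    have h1 := HasFDerivAt.comp_hasDerivAt (f := fun s : ℝ => s • (x : R4)) 1
      (by simpa using hFd) hline
    have h2 := (hasDerivAt_const (1 : ℝ) (x : R4)).inner ℝ h1
    -- `F` is orthogonal to `x` along the whole ray through `x`.
    have h3 : (fun s : ℝ => inner ℝ (x : R4) (F (s • (x : R4)))) =ᶠ[nhds 1] fun _ => (0 : ℝ) := by
      filter_upwards [isOpen_ne.mem_nhds (one_ne_zero (α := ℝ))] with s hs
      have := hr (s • (x : R4))
      rw [real_inner_smul_left] at this
      exact (mul_eq_zero.1 this).resolve_left hs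
    have h4 := h2.unique ((hasDerivAt_const (1 : ℝ) (0 : ℝ)).congr_of_eventuallyEq h3)
    simpa using h4
  have hcov : covariantDerivative X x =
      ((Submodule.span ℝ {(x : R4)})ᗮ.orthogonalProjectionOnto.toLinearMap ∘ₗ
        (D.comp (ContinuousLinearMap.id ℝ R4
          - (innerSL ℝ (x : R4)).smulRight (x : R4))).toLinearMap) ∘ₗ
          (Submodule.span ℝ {(x : R4)})ᗮ.subtype := by
    rw [covariantDerivative, hrad.fderiv]; rfl
  rw [divergence, hcov, LinearMap.trace_comp_comm', ← LinearMap.comp_assoc]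
  have hproj : (Submodule.span ℝ {(x : R4)})ᗮ.subtype ∘ₗ
      (Submodule.span ℝ {(x : R4)})ᗮ.orthogonalProjectionOnto.toLinearMap
      = LinearMap.id - ((innerSL ℝ (x : R4)).smulRight (x : R4)).toLinearMap := by
    ext1 v
    have h1 := Submodule.starProjection_orthogonal_val (K := Submodule.span ℝ {(x : R4)}) v
    rw [Submodule.starProjection_unit_singleton ℝ hn] at h1
    simpa using h1
  rw [hproj, LinearMap.trace_eq_sum_inner _ (EuclideanSpace.basisFun (Fin 4) ℝ)]
  have hcomp : ∀ v : R4, (LinearMap.id (R := ℝ) (M := R4)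
      - ((innerSL ℝ (x : R4)).smulRight (x : R4)).toLinearMap) v
      = v - inner ℝ (x : R4) v • (x : R4) := fun v => by simp
  have hcomp' : ∀ v : R4, (ContinuousLinearMap.id ℝ R4 - (innerSL ℝ (x : R4)).smulRight (x : R4)) v
      = v - inner ℝ (x : R4) v • (x : R4) := fun v => by simp
  have hterm : ∀ i : Fin 4, inner ℝ (EuclideanSpace.basisFun (Fin 4) ℝ i)
      (((LinearMap.id - ((innerSL ℝ (x : R4)).smulRight (x : R4)).toLinearMap) ∘ₗ
        (D.comp (ContinuousLinearMap.id ℝ R4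
          - (innerSL ℝ (x : R4)).smulRight (x : R4))).toLinearMap)
        (EuclideanSpace.basisFun (Fin 4) ℝ i)) = D (EuclideanSpace.single i 1) i
          - (x : R4) i * D x i
          - inner ℝ (x : R4) (D ((x : R4) i • EuclideanSpace.single i 1)) := by
    intro i
    rw [LinearMap.comp_apply, hcomp, ContinuousLinearMap.coe_coe, ContinuousLinearMap.comp_apply,
      hcomp']
    simp only [EuclideanSpace.basisFun_apply, EuclideanSpace.inner_single_left, map_sub, map_smul,
      inner_sub_right, inner_smul_right, hDx, EuclideanSpace.inner_single_right]
    simp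
    ring
  rw [Finset.sum_congr rfl fun i _ => hterm i, Finset.sum_sub_distrib, Finset.sum_sub_distrib,
    ← inner_sum, ← map_sum]
  have hsum : ∑ i, (x : R4) i • EuclideanSpace.single i (1 : ℝ) = (x : R4) := by
    ext j; simp [Finset.sum_apply, Pi.single_apply]
  have hin : ∑ i, (x : R4) i * D x i = 0 := by
    rw [← hDx, PiLp.inner_apply]; simp [mul_comm]
  rw [hsum, hDx, hin]
  simp

/-- The symmetry of the second derivative of the potential. -/
theorem symplGrad_divergence {k : ℝ} {W : ℂ} (hk : |k| < 1 / 2) (hW : Complex.normSq W ≤ 1) :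
    (fderiv ℝ (symplGrad k) W 1).re + (fderiv ℝ (symplGrad k) W Complex.I).im = 0 := by
  have hs : IsSymmSndFDerivAt ℝ (potential k) W :=
    (contDiffAt_potential hk hW).isSymmSndFDerivAt (by simp)
  have h1 : DifferentiableAt ℝ (fderiv ℝ (potential k)) W :=
    ((contDiffAt_potential hk hW).fderiv_right (m := ω) (by simp)).differentiableAt (by simp)
  have hG := ((contDiffAt_symplGrad hk hW).differentiableAt (by simp)).hasFDerivAt
  have hre := (Complex.reCLM.hasFDerivAt.comp W hG).unique
    ((h1.hasFDerivAt.clm_apply (hasFDerivAt_const Complex.I W)).neg)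
  have him := (Complex.imCLM.hasFDerivAt.comp W hG).unique
    (h1.hasFDerivAt.clm_apply (hasFDerivAt_const (1 : ℂ) W))
  have e1 := DFunLike.congr_fun hre 1
  have e2 := DFunLike.congr_fun him Complex.I
  simp at e1 e2
  rw [e1, e2, hs.eq 1 Complex.I]
  ring

/-- The divergence is `2 (|z₁|² - |z₂|²) (Re ∂G/∂a + Im ∂G/∂b)`, since `-z̄₂` and `z̄₁` contribute
nothing: the coefficient of `G` in each component is antiholomorphic in the other variable. -/
theorem divergence_field {k : ℝ} (hk : |k| < 1 / 2) (x : S3) : divergence (field k) x = 0 := by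
  have hW := normSq_two_mul_le x
  rw [divergence_eq_trace (X := field k) ((contDiffAt_ambientField hk x).differentiableAt (by simp))
    (fun _ => rfl) (fun y => inner_frame y _)]
  have hF := ((contDiffAt_ambientField hk x).differentiableAt (by simp)).hasFDerivAt
  have hG := ((contDiffAt_symplGrad hk hW).differentiableAt (by simp)).hasFDerivAt
  have hW' : HasFDerivAt (fun y : R4 => 2 * (z₁ y * z₂ y)) _ (x : R4) :=
    ((z₁L.hasFDerivAt (x := (x : R4))).mul (z₂L.hasFDerivAt (x := (x : R4)))).const_mul 2
  have hGW := HasFDerivAt.comp (x : R4) hG hW'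
  have c1 := (Complex.conjCLE.toContinuousLinearMap.hasFDerivAt.comp (x : R4)
    (z₁L.hasFDerivAt (x := (x : R4)))).mul hGW
  have c2 := ((Complex.conjCLE.toContinuousLinearMap.hasFDerivAt.comp (x : R4)
    (z₂L.hasFDerivAt (x := (x : R4)))).neg).mul hGW
  have d1 := (z₁L.hasFDerivAt.comp (x : R4) hF).unique (c2.congr_of_eventuallyEq (.of_forall
    fun y => by simp [ambientField, frame]))
  have d2 := (z₂L.hasFDerivAt.comp (x : R4) hF).unique (c1.congr_of_eventuallyEq (.of_forall
    fun y => by simp [ambientField, frame]))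
  have t0 := congrArg Complex.re (DFunLike.congr_fun d1 (EuclideanSpace.single 0 1))
  have t1 := congrArg Complex.im (DFunLike.congr_fun d1 (EuclideanSpace.single 1 1))
  have t2 := congrArg Complex.re (DFunLike.congr_fun d2 (EuclideanSpace.single 2 1))
  have t3 := congrArg Complex.im (DFunLike.congr_fun d2 (EuclideanSpace.single 3 1))
  have hlin : ∀ w : ℂ, fderiv ℝ (symplGrad k) (2 * (z₁ x * z₂ x)) w
      = w.re * fderiv ℝ (symplGrad k) (2 * (z₁ x * z₂ x)) 1
        + w.im * fderiv ℝ (symplGrad k) (2 * (z₁ x * z₂ x)) Complex.I := by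
    intro w
    have : w = w.re • (1 : ℂ) + w.im • Complex.I := by apply Complex.ext <;> simp
    conv_lhs => rw [this]
    rw [map_add, map_smul, map_smul, Complex.real_smul, Complex.real_smul]
  have hdiv := symplGrad_divergence hk hW
  have hz : ∀ i : Fin 4, z₁ (EuclideanSpace.single i 1) = ![1, Complex.I, 0, 0] i ∧
      z₂ (EuclideanSpace.single i 1) = ![0, 0, 1, Complex.I] i := by
    intro i
    fin_cases i <;> constructor <;> apply Complex.ext <;> simp [z₁, z₂]
  simp only [ContinuousLinearMap.comp_apply, z₁L_apply, z₂L_apply, add_apply, smul_apply,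
    neg_apply, (hz _).1, (hz _).2, hlin (_ • _), ContinuousLinearEquiv.coe_coe] at t0 t1 t2 t3
  simp only [Function.comp, z₁L_apply] at t0 t1 t2 t3
  generalize fderiv ℝ (symplGrad k) (2 * (z₁ x * z₂ x)) 1 = L1 at *
  generalize fderiv ℝ (symplGrad k) (2 * (z₁ x * z₂ x)) Complex.I = LI at *
  rw [Fin.sum_univ_four]
  simp at t0 t1 t2 t3
  change (z₁ _).re + (z₁ _).im + (z₂ _).re + (z₂ _).im = 0
  rw [t0, t1, t2, t3]
  linear_combination (2 * ((z₁ x).re ^ 2 + (z₁ x).im ^ 2) - 2 * ((z₂ x).re ^ 2 + (z₂ x).im ^ 2))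
    * hdiv

/-! ### The twist -/

/-- The unit complex number `κ` with `κ² = C / |C|` and positive real part, for `0 < C.re`. -/
noncomputable def halfPhase (C : ℂ) : ℂ := (C + ‖C‖) / ‖C + ‖C‖‖

theorem add_norm_ne_zero {C : ℂ} (hC : 0 < C.re) : C + ‖C‖ ≠ 0 := by
  intro h
  have := congrArg Complex.re h
  simp at this
  linarith [norm_nonneg C]

theorem norm_halfPhase {C : ℂ} (hC : 0 < C.re) : ‖halfPhase C‖ = 1 := by
  rw [halfPhase, norm_div, Complex.norm_real, norm_norm]
  exact div_self (norm_ne_zero_iff.2 (add_norm_ne_zero hC))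

theorem halfPhase_mul_conj {C : ℂ} (hC : 0 < C.re) : halfPhase C * conj (halfPhase C) = 1 := by
  rw [Complex.mul_conj, Complex.normSq_eq_norm_sq, norm_halfPhase hC]; simp

theorem halfPhase_sq_mul {C : ℂ} (hC : 0 < C.re) : halfPhase C ^ 2 * ‖C‖ = C := by
  have h0 := add_norm_ne_zero hC
  have h1 : ((‖C + ‖C‖‖ : ℝ) : ℂ) ≠ 0 := by simpa using h0
  have h2 : ((‖C + ‖C‖‖ : ℝ) : ℂ) ^ 2 = (C + ‖C‖) * (conj C + ‖C‖) := by
    rw [← Complex.ofReal_pow, ← Complex.normSq_eq_norm_sq, ← Complex.mul_conj]; simp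
  have h3 : ((‖C‖ : ℝ) : ℂ) ^ 2 = C * conj C := by
    rw [← Complex.ofReal_pow, ← Complex.normSq_eq_norm_sq, Complex.mul_conj]
  rw [halfPhase, div_pow, div_mul_eq_mul_div, div_eq_iff (pow_ne_zero 2 h1), h2]
  linear_combination (C + ‖C‖) * h3

theorem contDiffAt_halfPhase {n : WithTop ℕ∞} {C : ℂ} (hC : 0 < C.re) :
    ContDiffAt ℝ n halfPhase C := by
  have hne : C ≠ 0 := fun h => by simp [h] at hC
  have h1 : ContDiffAt ℝ n (fun C : ℂ => C + (‖C‖ : ℂ)) C :=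
    contDiffAt_id.add (contDiff_ofReal.contDiffAt.comp C (contDiffAt_norm ℝ hne))
  have h2 := h1.norm ℝ (add_norm_ne_zero hC)
  have h3 : ContDiffAt ℝ n (fun C : ℂ => (C + ‖C‖) * ((‖C + ‖C‖‖ : ℝ) : ℂ)⁻¹) C :=
    h1.mul ((contDiff_ofReal.contDiffAt.comp C h2).inv (by simpa using add_norm_ne_zero hC))
  exact h3

/-- The quantity `1 - k |a|²`. -/
noncomputable def cA (k : ℝ) (a : ℂ) : ℝ := 1 - k * Complex.normSq a
/-- The quantity `1 + k |b|²`. -/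
noncomputable def cB (k : ℝ) (b : ℂ) : ℝ := 1 + k * Complex.normSq b
/-- The complex number whose half phase is the phase factor of the twist. Its phase is the one that
makes the twisted leaves Legendrian; see `re_disc_mul_wronskian`. -/
noncomputable def disc (k : ℝ) (a b : ℂ) : ℂ := (cA k a * cB k b : ℝ) - (k * (a * b)) ^ 2
/-- The first component of the twist, up to a phase and a positive factor. -/
noncomputable def pre₁ (k : ℝ) (a b : ℂ) : ℂ := cB k b * a + k * conj (a * b) * conj b
/-- The second component of the twist, up to a phase and a positive factor. -/
noncomputable def pre₂ (k : ℝ) (a b : ℂ) : ℂ := cA k a * b - k * conj (a * b) * conj a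
/-- `|a|² - |b|²`. -/
noncomputable def normSqSub (a b : ℂ) : ℝ := Complex.normSq a - Complex.normSq b

/-- The first component of `twist`. -/
noncomputable def twist₁ (k : ℝ) (a b : ℂ) : ℂ :=
  halfPhase (disc k a b) * (√(cA k a) * pre₁ k a b) / √(vel k (normSqSub a b))
/-- The second component of `twist`. -/
noncomputable def twist₂ (k : ℝ) (a b : ℂ) : ℂ :=
  halfPhase (disc k a b) * (√(cB k b) * pre₂ k a b) / √(vel k (normSqSub a b))

theorem normSq_pre₁ (k : ℝ) (a b : ℂ) : Complex.normSq (pre₁ k a b) =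
    cB k b ^ 2 * Complex.normSq a + k ^ 2 * Complex.normSq a * Complex.normSq b ^ 2
      + 2 * k * cB k b * ((a * b) ^ 2).re := by
  simp only [pre₁]
  generalize cB k b = B
  simp [Complex.normSq_apply, pow_two]
  ring

theorem normSq_pre₂ (k : ℝ) (a b : ℂ) : Complex.normSq (pre₂ k a b) =
    cA k a ^ 2 * Complex.normSq b + k ^ 2 * Complex.normSq a ^ 2 * Complex.normSq b
      - 2 * k * cA k a * ((a * b) ^ 2).re := by
  simp only [pre₂]
  generalize cA k a = A
  simp [Complex.normSq_apply, pow_two]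
  ring

section

variable {k : ℝ} {a b : ℂ}

theorem cA_pos (hk : |k| < 1 / 2) (h : Complex.normSq a + Complex.normSq b = 1) : 0 < cA k a := by
  have := abs_lt.1 hk
  unfold cA
  nlinarith [Complex.normSq_nonneg a, Complex.normSq_nonneg b]

theorem cB_pos (hk : |k| < 1 / 2) (h : Complex.normSq a + Complex.normSq b = 1) : 0 < cB k b := by
  have := abs_lt.1 hk
  unfold cB
  nlinarith [Complex.normSq_nonneg a, Complex.normSq_nonneg b]

theorem abs_normSqSub_le (h : Complex.normSq a + Complex.normSq b = 1) : |normSqSub a b| ≤ 1 := by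
  unfold normSqSub
  rw [abs_le]
  constructor <;> linarith [Complex.normSq_nonneg a, Complex.normSq_nonneg b]

theorem vel_pos (hk : |k| < 1 / 2) (h : Complex.normSq a + Complex.normSq b = 1) :
    0 < vel k (normSqSub a b) := by
  linarith [le_vel (k := k) (abs_normSqSub_le h)]

theorem cA_mul_cB_add (k : ℝ) (a b : ℂ) :
    cA k a * cB k b + k ^ 2 * (Complex.normSq a * Complex.normSq b) = vel k (normSqSub a b) := by
  unfold cA cB vel normSqSub; ring

theorem cA_mul_cB_sub (h : Complex.normSq a + Complex.normSq b = 1) :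
    2 * (cA k a * cB k b - k ^ 2 * (Complex.normSq a * Complex.normSq b))
      = vel k (normSqSub a b) ^ 2 + (1 - k ^ 2) := by
  have hb : Complex.normSq b = 1 - Complex.normSq a := by linarith
  unfold cA cB vel normSqSub; rw [hb]; ring

theorem four_mul_cA_mul_cB (h : Complex.normSq a + Complex.normSq b = 1) :
    4 * (cA k a * cB k b) = (1 + vel k (normSqSub a b)) ^ 2 - k ^ 2 := by
  have hb : Complex.normSq b = 1 - Complex.normSq a := by linarith
  unfold cA cB vel normSqSub; rw [hb]; ring

theorem half_lt_cA_mul_cB_sub (hk : |k| < 1 / 2) (h : Complex.normSq a + Complex.normSq b = 1) :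
    1 / 2 < cA k a * cB k b - k ^ 2 * (Complex.normSq a * Complex.normSq b) := by
  have h1 := cA_mul_cB_sub (k := k) h
  have h2 := (admissible_of_mem (ν := 0) hk (abs_normSqSub_le h) le_rfl zero_le_one).ecc_lt
  simp [ecc] at h2
  nlinarith

theorem disc_re (k : ℝ) (a b : ℂ) : (disc k a b).re =
    cA k a * cB k b - k ^ 2 * (Complex.normSq a * Complex.normSq b) + 2 * (k * (a * b).im) ^ 2 := by
  simp [disc, Complex.normSq_apply, pow_two]; ring

theorem disc_re_pos (hk : |k| < 1 / 2) (h : Complex.normSq a + Complex.normSq b = 1) :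
    0 < (disc k a b).re := by
  rw [disc_re]; have := half_lt_cA_mul_cB_sub hk h; positivity

theorem norm_disc_sq (k : ℝ) (a b : ℂ) : ‖disc k a b‖ ^ 2 =
    (cA k a * cB k b - k ^ 2 * (Complex.normSq a * Complex.normSq b)) ^ 2
      + 4 * (cA k a * cB k b) * (k * (a * b).im) ^ 2 := by
  rw [← Complex.normSq_eq_norm_sq]
  simp only [disc]
  generalize cA k a * cB k b = q
  simp [Complex.normSq_apply, pow_two]
  ring

theorem cA_normSq_add (h : Complex.normSq a + Complex.normSq b = 1) :
    cA k a * Complex.normSq (pre₁ k a b) + cB k b * Complex.normSq (pre₂ k a b)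
      = vel k (normSqSub a b) := by
  rw [normSq_pre₁, normSq_pre₂, ← cA_mul_cB_add k a b]
  have e : cB k b * Complex.normSq a + cA k a * Complex.normSq b = 1 := by
    unfold cA cB; linear_combination h
  linear_combination (cA k a * cB k b + k ^ 2 * (Complex.normSq a * Complex.normSq b)) * e

theorem cA_normSq_sub (k : ℝ) (a b : ℂ) :
    cA k a * Complex.normSq (pre₁ k a b) - cB k b * Complex.normSq (pre₂ k a b)
      = (cA k a * cB k b - k ^ 2 * (Complex.normSq a * Complex.normSq b))
        * (normSqSub a b + 2 * k * (Complex.normSq a * Complex.normSq b))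
        + 4 * k * (cA k a * cB k b) * (Complex.normSq a * Complex.normSq b - 2 * (a * b).im ^ 2) := by
  have e : ((a * b) ^ 2).re = Complex.normSq a * Complex.normSq b - 2 * (a * b).im ^ 2 := by
    simp [Complex.normSq_apply, pow_two]; ring
  have e' : cB k b * Complex.normSq a - cA k a * Complex.normSq b
      = normSqSub a b + 2 * k * (Complex.normSq a * Complex.normSq b) := by
    unfold cA cB normSqSub; ring
  rw [normSq_pre₁, normSq_pre₂, e]
  linear_combination (cA k a * cB k b - k ^ 2 * (Complex.normSq a * Complex.normSq b)) * e'

theorem pre_mul (k : ℝ) (a b : ℂ) : pre₁ k a b * pre₂ k a b =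
    (cA k a * cB k b : ℝ) * (a * b)
      - k * (normSqSub a b + 2 * k * (Complex.normSq a * Complex.normSq b) : ℝ) * conj (a * b)
      - k ^ 2 * conj (a * b) ^ 3 := by
  have e' : normSqSub a b + 2 * k * (Complex.normSq a * Complex.normSq b) =
    cB k b * Complex.normSq a - cA k a * Complex.normSq b := by
    unfold cA cB normSqSub; ring
  rw [e', pre₁, pre₂]
  push_cast
  rw [← Complex.mul_conj, ← Complex.mul_conj]
  simp only [map_mul]
  ring

/-- Both parts of the product of the components of the twist, before normalization. -/
theorem disc_mul_pre (k : ℝ) (a b : ℂ) :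
    (disc k a b * (pre₁ k a b * pre₂ k a b)).im = vel k (normSqSub a b) * (a * b).im ∧
    (disc k a b * (pre₁ k a b * pre₂ k a b)).re = (a * b).re * (2 * ‖disc k a b‖ ^ 2
      - (cA k a * cB k b - k ^ 2 * (Complex.normSq a * Complex.normSq b))) := by
  have e : cA k a * cB k b - k ^ 2 * (Complex.normSq a * Complex.normSq b)
    + k * (normSqSub a b + 2 * k * (Complex.normSq a * Complex.normSq b)) = 1 := by
    unfold cA cB normSqSub; ring
  have hx : Complex.normSq a * Complex.normSq b = (a * b).re ^ 2 + (a * b).im ^ 2 := by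
    rw [← map_mul, Complex.normSq_apply]; ring
  have hs := cA_mul_cB_add k a b
  rw [norm_disc_sq, ← hs, pre_mul, disc]
  generalize normSqSub a b + 2 * k * (Complex.normSq a * Complex.normSq b) = δ at *
  rw [hx] at *
  generalize cA k a * cB k b = q at *
  generalize a * b = u at *
  have hkd : k * δ = 1 - q + k ^ 2 * (u.re ^ 2 + u.im ^ 2) := by linarith
  rw [← Complex.ofReal_mul, hkd]
  constructor
  · simp [pow_succ]; ring
  · simp [pow_succ]; ring

theorem normSq_halfPhase (hk : |k| < 1 / 2) (h : Complex.normSq a + Complex.normSq b = 1) :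
    Complex.normSq (halfPhase (disc k a b)) = 1 := by
  rw [Complex.normSq_eq_norm_sq, norm_halfPhase (disc_re_pos hk h)]; norm_num

theorem normSq_twist₁ (hk : |k| < 1 / 2) (h : Complex.normSq a + Complex.normSq b = 1) :
    Complex.normSq (twist₁ k a b) =
      cA k a * Complex.normSq (pre₁ k a b) / vel k (normSqSub a b) := by
  rw [twist₁, map_div₀, map_mul, map_mul, normSq_halfPhase hk h, Complex.normSq_ofReal,
    Complex.normSq_ofReal, Real.mul_self_sqrt (cA_pos hk h).le,
    Real.mul_self_sqrt (vel_pos hk h).le, one_mul]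

theorem normSq_twist₂ (hk : |k| < 1 / 2) (h : Complex.normSq a + Complex.normSq b = 1) :
    Complex.normSq (twist₂ k a b) =
      cB k b * Complex.normSq (pre₂ k a b) / vel k (normSqSub a b) := by
  rw [twist₂, map_div₀, map_mul, map_mul, normSq_halfPhase hk h, Complex.normSq_ofReal,
    Complex.normSq_ofReal, Real.mul_self_sqrt (cB_pos hk h).le,
    Real.mul_self_sqrt (vel_pos hk h).le, one_mul]

theorem normSq_twist_add (hk : |k| < 1 / 2) (h : Complex.normSq a + Complex.normSq b = 1) :
    Complex.normSq (twist₁ k a b) + Complex.normSq (twist₂ k a b) = 1 := by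
  rw [normSq_twist₁ hk h, normSq_twist₂ hk h, ← add_div, cA_normSq_add h,
    div_self (vel_pos hk h).ne']

theorem twist_mul (hk : |k| < 1 / 2) (h : Complex.normSq a + Complex.normSq b = 1) :
    twist₁ k a b * twist₂ k a b * (‖disc k a b‖ * vel k (normSqSub a b) : ℝ) =
      (√(cA k a * cB k b) : ℝ) * (disc k a b * (pre₁ k a b * pre₂ k a b)) := by
  have h1 := halfPhase_sq_mul (disc_re_pos hk h)
  have hV := (vel_pos hk h)
  have h2 : ((√(vel k (normSqSub a b)) : ℝ) : ℂ) ^ 2 = (vel k (normSqSub a b) : ℝ) := by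
    rw [← Complex.ofReal_pow, Real.sq_sqrt hV.le]
  have h3 : ((√(vel k (normSqSub a b)) : ℝ) : ℂ) ≠ 0 := by
    simpa using (Real.sqrt_pos.2 hV).ne'
  rw [twist₁, twist₂, Real.sqrt_mul (cA_pos hk h).le]
  push_cast
  conv_rhs => rw [← h1]
  rw [← h2]
  field_simp

theorem norm_disc_pos (hk : |k| < 1 / 2) (h : Complex.normSq a + Complex.normSq b = 1) :
    0 < ‖disc k a b‖ := by
  rw [norm_pos_iff]
  intro h0
  have := disc_re_pos hk h
  simp [h0] at this

theorem twist_mul_im (hk : |k| < 1 / 2) (h : Complex.normSq a + Complex.normSq b = 1) :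
    (twist₁ k a b * twist₂ k a b).im * ‖disc k a b‖ = √(cA k a * cB k b) * (a * b).im := by
  have h1 := congrArg Complex.im (twist_mul hk h)
  rw [Complex.im_mul_ofReal, Complex.im_ofReal_mul, (disc_mul_pre k a b).1] at h1
  have hV := (vel_pos hk h).ne'
  apply mul_right_cancel₀ hV
  linear_combination h1

theorem twist_mul_re (hk : |k| < 1 / 2) (h : Complex.normSq a + Complex.normSq b = 1) :
    (twist₁ k a b * twist₂ k a b).re * (‖disc k a b‖ * vel k (normSqSub a b)) =
      √(cA k a * cB k b) * ((a * b).re * (2 * ‖disc k a b‖ ^ 2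
      - (cA k a * cB k b - k ^ 2 * (Complex.normSq a * Complex.normSq b)))) := by
  have h1 := congrArg Complex.re (twist_mul hk h)
  rwa [Complex.re_mul_ofReal, Complex.re_ofReal_mul, (disc_mul_pre k a b).2] at h1

/-- `(2 Im (a b))²`; the value of `1 - |W|²` after the rotation of `two_mul_rot`. -/
noncomputable def imSq (a b : ℂ) : ℝ := (2 * (a * b)).im ^ 2

theorem imSq_eq (a b : ℂ) : imSq a b = 4 * (a * b).im ^ 2 := by
  rw [imSq, show (2 * (a * b) : ℂ) = ((2 : ℝ) : ℂ) * (a * b) by norm_num,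
    Complex.im_ofReal_mul]; ring

theorem imSq_twist (hk : |k| < 1 / 2) (h : Complex.normSq a + Complex.normSq b = 1) :
    imSq (twist₁ k a b) (twist₂ k a b) * ‖disc k a b‖ ^ 2
      = 4 * (cA k a * cB k b) * (a * b).im ^ 2 := by
  have h1 := twist_mul_im hk h
  have h2 : √(cA k a * cB k b) ^ 2 = cA k a * cB k b :=
    Real.sq_sqrt (mul_pos (cA_pos hk h) (cB_pos hk h)).le
  rw [imSq_eq]
  linear_combination 4 * ((twist₁ k a b * twist₂ k a b).im * ‖disc k a b‖ +
    √(cA k a * cB k b) * (a * b).im) * h1 + 4 * (a * b).im ^ 2 * h2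

theorem ecc_twist (hk : |k| < 1 / 2) (h : Complex.normSq a + Complex.normSq b = 1) :
    ecc k (imSq (twist₁ k a b) (twist₂ k a b)) * ‖disc k a b‖ ^ 2
      = (cA k a * cB k b - k ^ 2 * (Complex.normSq a * Complex.normSq b)) ^ 2 := by
  have h1 := imSq_twist hk h
  have h2 := norm_disc_sq k a b
  unfold ecc
  linear_combination h2 - k ^ 2 * h1

theorem imSq_mem (h : Complex.normSq a + Complex.normSq b = 1) :
    0 ≤ imSq a b ∧ imSq a b ≤ 1 ∧ normSqSub a b ^ 2 ≤ 1 - imSq a b := by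
  have hx : Complex.normSq a * Complex.normSq b = (a * b).re ^ 2 + (a * b).im ^ 2 := by
    rw [← map_mul, Complex.normSq_apply]; ring
  have h3 : normSqSub a b ^ 2 + 4 * (Complex.normSq a * Complex.normSq b) = 1 := by
    unfold normSqSub
    linear_combination (Complex.normSq a + Complex.normSq b + 1) * h
  rw [imSq_eq]
  refine ⟨by positivity, ?_, ?_⟩
  · nlinarith [sq_nonneg (normSqSub a b), sq_nonneg (a * b).re]
  · nlinarith [sq_nonneg (a * b).re]

/-- The identity on which the definitions of `height` and of the potential rest. -/
theorem height_twist (hk : |k| < 1 / 2) (h : Complex.normSq a + Complex.normSq b = 1) :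
    height k (normSqSub a b) (imSq (twist₁ k a b) (twist₂ k a b))
      = normSqSub (twist₁ k a b) (twist₂ k a b) := by
  have hV := (vel_pos hk h).ne'
  have hC := (norm_disc_pos hk h).ne'
  have hhalf := half_lt_cA_mul_cB_sub hk h
  have e1 := ecc_twist hk h
  have e2 := imSq_twist hk h
  have e3 := cA_mul_cB_sub (k := k) h
  have hE : ecc k (imSq (twist₁ k a b) (twist₂ k a b)) ≠ 0 := by
    intro h0
    rw [h0, zero_mul] at e1
    have := pow_eq_zero_iff two_ne_zero |>.1 e1.symm
    linarith
  have e4 : imSq (twist₁ k a b) (twist₂ k a b) * (vel k (normSqSub a b) ^ 2 + (1 - k ^ 2)) ^ 2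
      / ecc k (imSq (twist₁ k a b) (twist₂ k a b))
      = 16 * (cA k a * cB k b) * (a * b).im ^ 2 := by
    rw [div_eq_iff hE, ← e3]
    apply mul_right_cancel₀ (pow_ne_zero 2 hC)
    linear_combination 4 * (cA k a * cB k b
      - k ^ 2 * (Complex.normSq a * Complex.normSq b)) ^ 2 * e2
      - 16 * (cA k a * cB k b) * (a * b).im ^ 2 * e1
  rw [height, mul_assoc k, mul_div_assoc k, e4, show normSqSub (twist₁ k a b) (twist₂ k a b)
    = (cA k a * Complex.normSq (pre₁ k a b) - cB k b * Complex.normSq (pre₂ k a b))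
      / vel k (normSqSub a b) by
    rw [normSqSub, normSq_twist₁ hk h, normSq_twist₂ hk h, sub_div], cA_normSq_sub]
  have hb : Complex.normSq b = 1 - Complex.normSq a := by linarith
  rw [div_eq_div_iff (by simpa using hV) hV]
  unfold cA cB vel normSqSub
  rw [hb]
  ring

theorem admissible_twist (hk : |k| < 1 / 2) (h : Complex.normSq a + Complex.normSq b = 1) :
    Admissible k (normSqSub a b) (imSq (twist₁ k a b) (twist₂ k a b)) :=
  admissible_of_mem hk (abs_normSqSub_le h) (imSq_mem (normSq_twist_add hk h)).1
    (imSq_mem (normSq_twist_add hk h)).2.1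

theorem level_twist (hk : |k| < 1 / 2) (h : Complex.normSq a + Complex.normSq b = 1) :
    level k (normSqSub (twist₁ k a b) (twist₂ k a b)) (imSq (twist₁ k a b) (twist₂ k a b))
      = normSqSub a b := by
  rw [← height_twist hk h]
  exact level_height (admissible_twist hk h)

end

/-! ### The inverse of the twist -/

/-- The value of `normSqSub` at the preimage under the twist. The following definitions likewise
compute quantities at the preimage from the image point; see the lemmas `src…_twist`. -/
noncomputable def srcLevel (k : ℝ) (a b : ℂ) : ℝ := level k (normSqSub a b) (imSq a b)

/-- The value of `cA * cB` at the preimage under the twist. -/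
noncomputable def srcQ (k : ℝ) (a b : ℂ) : ℝ := ((1 + vel k (srcLevel k a b)) ^ 2 - k ^ 2) / 4

/-- The value of `2 (cA * cB - k² |a|² |b|²)` at the preimage under the twist. -/
noncomputable def srcW (k : ℝ) (a b : ℂ) : ℝ := vel k (srcLevel k a b) ^ 2 + (1 - k ^ 2)

/-- The product of the two complex coordinates of the preimage under the twist. -/
noncomputable def srcMul (k : ℝ) (a b : ℂ) : ℂ :=
  (((a * b).re * (vel k (srcLevel k a b) * √(ecc k (imSq a b)))
      / (√(srcQ k a b) * (srcW k a b - ecc k (imSq a b))) : ℝ) : ℂ)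
    + (((a * b).im * srcW k a b / (2 * √(srcQ k a b) * √(ecc k (imSq a b))) : ℝ) : ℂ) * Complex.I

/-- The value of `disc` at the preimage under the twist. -/
noncomputable def srcDisc (k : ℝ) (a b : ℂ) : ℂ := (srcQ k a b : ℝ) - (k * srcMul k a b) ^ 2

/-- The factor that removes the phase and the factor `1 / √vel` from the components of the twist. -/
noncomputable def srcPhase (k : ℝ) (a b : ℂ) : ℂ :=
  conj (halfPhase (srcDisc k a b)) * √(vel k (srcLevel k a b))

/-- The first component of `untwist`. Once the phase and the product of the coordinates are known,
`pre₁` and the conjugate of `pre₂` are a linear system for `a` and `b̄`, with determinant `vel`. -/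
noncomputable def untwist₁ (k : ℝ) (a b : ℂ) : ℂ :=
  (√(srcQ k a b) * (srcPhase k a b * a)
    - k * conj (srcMul k a b) * conj (srcPhase k a b * b)) *
    ((vel k (srcLevel k a b) * √(1 + k * ((1 - srcLevel k a b) / 2)))⁻¹ : ℝ)

/-- The second component of `untwist`. -/
noncomputable def untwist₂ (k : ℝ) (a b : ℂ) : ℂ :=
  (√(srcQ k a b) * (srcPhase k a b * b)
    + k * conj (srcMul k a b) * conj (srcPhase k a b * a)) *
    ((vel k (srcLevel k a b) * √(1 - k * ((1 + srcLevel k a b) / 2)))⁻¹ : ℝ)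

section

variable {k : ℝ} {a b : ℂ}

theorem srcLevel_twist (hk : |k| < 1 / 2) (h : Complex.normSq a + Complex.normSq b = 1) :
    srcLevel k (twist₁ k a b) (twist₂ k a b) = normSqSub a b := level_twist hk h

theorem srcQ_twist (hk : |k| < 1 / 2) (h : Complex.normSq a + Complex.normSq b = 1) :
    srcQ k (twist₁ k a b) (twist₂ k a b) = cA k a * cB k b := by
  rw [srcQ, srcLevel_twist hk h, ← four_mul_cA_mul_cB h]; ring

theorem srcW_twist (hk : |k| < 1 / 2) (h : Complex.normSq a + Complex.normSq b = 1) :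
    srcW k (twist₁ k a b) (twist₂ k a b) =
      2 * (cA k a * cB k b - k ^ 2 * (Complex.normSq a * Complex.normSq b)) := by
  rw [srcW, srcLevel_twist hk h, ← cA_mul_cB_sub h]

theorem sqrt_ecc_twist (hk : |k| < 1 / 2) (h : Complex.normSq a + Complex.normSq b = 1) :
    √(ecc k (imSq (twist₁ k a b) (twist₂ k a b)))
      = (cA k a * cB k b - k ^ 2 * (Complex.normSq a * Complex.normSq b)) / ‖disc k a b‖ := by
  have h1 := ecc_twist hk h
  have h2 := norm_disc_pos hk h
  have h3 := half_lt_cA_mul_cB_sub hk h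
  rw [show ecc k (imSq (twist₁ k a b) (twist₂ k a b)) =
    ((cA k a * cB k b - k ^ 2 * (Complex.normSq a * Complex.normSq b)) / ‖disc k a b‖) ^ 2 by
      rw [div_pow, eq_div_iff (by positivity), h1]]
  exact Real.sqrt_sq (div_nonneg (by linarith) h2.le)

theorem srcMul_twist (hk : |k| < 1 / 2) (h : Complex.normSq a + Complex.normSq b = 1) :
    srcMul k (twist₁ k a b) (twist₂ k a b) = a * b := by
  have hq := Real.sqrt_pos.2 (mul_pos (cA_pos hk h) (cB_pos hk h))
  have hC := norm_disc_pos hk h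
  have hhalf := half_lt_cA_mul_cB_sub hk h
  have hV := vel_pos hk h
  have e1 := ecc_twist hk h
  have hre := twist_mul_re hk h
  have him := twist_mul_im hk h
  have hadm := (admissible_twist hk h).ecc_lt
  rw [← cA_mul_cB_sub h] at hadm
  rw [srcMul, srcLevel_twist hk h, srcQ_twist hk h, srcW_twist hk h, sqrt_ecc_twist hk h]
  set q := cA k a * cB k b - k ^ 2 * (Complex.normSq a * Complex.normSq b)
  set E := ecc k (imSq (twist₁ k a b) (twist₂ k a b))
  set r := ‖disc k a b‖
  have hE : E = q ^ 2 / r ^ 2 := by rw [eq_div_iff (by positivity), e1]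
  have hne : 2 * q - E ≠ 0 := by linarith
  have hq0 : q ≠ 0 := by linarith
  have hq0' := hq.ne'
  have hV0 := hV.ne'
  have hC0 := hC.ne'
  apply Complex.ext
  · simp only [Complex.add_re, Complex.ofReal_re, Complex.re_ofReal_mul, Complex.I_re, mul_zero,
      add_zero]
    rw [div_eq_iff (mul_ne_zero hq0' hne), hE]
    field_simp
    linear_combination hre
  · simp only [Complex.add_im, Complex.ofReal_im, Complex.im_ofReal_mul, Complex.I_im, mul_one,
      zero_add]
    rw [div_eq_iff (by positivity)]
    field_simp
    linear_combination him

theorem srcDisc_twist (hk : |k| < 1 / 2) (h : Complex.normSq a + Complex.normSq b = 1) :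
    srcDisc k (twist₁ k a b) (twist₂ k a b) = disc k a b := by
  rw [srcDisc, srcQ_twist hk h, srcMul_twist hk h, disc]

theorem srcPhase_mul_twist (hk : |k| < 1 / 2) (h : Complex.normSq a + Complex.normSq b = 1) :
    srcPhase k (twist₁ k a b) (twist₂ k a b) * twist₁ k a b = √(cA k a) * pre₁ k a b ∧
    srcPhase k (twist₁ k a b) (twist₂ k a b) * twist₂ k a b = √(cB k b) * pre₂ k a b := by
  have h1 := halfPhase_mul_conj (disc_re_pos hk h)
  have h3 : ((√(vel k (normSqSub a b)) : ℝ) : ℂ) ≠ 0 := by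
    simpa using (Real.sqrt_pos.2 (vel_pos hk h)).ne'
  rw [srcPhase, srcDisc_twist hk h, srcLevel_twist hk h]
  constructor
  · rw [twist₁]; field_simp; linear_combination (√(cA k a) * pre₁ k a b) * h1
  · rw [twist₂]; field_simp; linear_combination (√(cB k b) * pre₂ k a b) * h1

theorem untwist₁_twist (hk : |k| < 1 / 2) (h : Complex.normSq a + Complex.normSq b = 1) :
    untwist₁ k (twist₁ k a b) (twist₂ k a b) = a := by
  have hA := cA_pos hk h
  have hB := cB_pos hk h
  have hV := vel_pos hk h
  have eA : ((√(cA k a) : ℝ) : ℂ) ^ 2 = (cA k a : ℝ) := by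
    rw [← Complex.ofReal_pow, Real.sq_sqrt hA.le]
  have e1 : 1 + k * ((1 - normSqSub a b) / 2) = cB k b := by
    have hb : Complex.normSq a = 1 - Complex.normSq b := by linarith
    unfold cB normSqSub; rw [hb]; ring
  rw [untwist₁, (srcPhase_mul_twist hk h).1, (srcPhase_mul_twist hk h).2, srcQ_twist hk h,
    srcMul_twist hk h, srcLevel_twist hk h, e1, Complex.ofReal_inv, ← div_eq_mul_inv,
    div_eq_iff (by simpa using ⟨hV.ne', (Real.sqrt_pos.2 hB).ne'⟩), Real.sqrt_mul hA.le,
    ← cA_mul_cB_add k a b]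
  push_cast
  rw [← Complex.mul_conj, ← Complex.mul_conj, pre₁, pre₂]
  simp only [map_mul, map_sub, Complex.conj_conj, Complex.conj_ofReal]
  linear_combination ((√(cB k b) : ℝ) * (cB k b * a + k * (conj a * conj b) * conj b) : ℂ) * eA

theorem untwist₂_twist (hk : |k| < 1 / 2) (h : Complex.normSq a + Complex.normSq b = 1) :
    untwist₂ k (twist₁ k a b) (twist₂ k a b) = b := by
  have hA := cA_pos hk h
  have hB := cB_pos hk h
  have hV := vel_pos hk h
  have eB : ((√(cB k b) : ℝ) : ℂ) ^ 2 = (cB k b : ℝ) := by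
    rw [← Complex.ofReal_pow, Real.sq_sqrt hB.le]
  have e1 : 1 - k * ((1 + normSqSub a b) / 2) = cA k a := by
    have hb : Complex.normSq b = 1 - Complex.normSq a := by linarith
    unfold cA normSqSub; rw [hb]; ring
  rw [untwist₂, (srcPhase_mul_twist hk h).1, (srcPhase_mul_twist hk h).2, srcQ_twist hk h,
    srcMul_twist hk h, srcLevel_twist hk h, e1, Complex.ofReal_inv, ← div_eq_mul_inv,
    div_eq_iff (by simpa using ⟨hV.ne', (Real.sqrt_pos.2 hA).ne'⟩), Real.sqrt_mul hA.le,
    ← cA_mul_cB_add k a b]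
  push_cast
  rw [← Complex.mul_conj, ← Complex.mul_conj, pre₁, pre₂]
  simp only [map_mul, map_add, Complex.conj_conj, Complex.conj_ofReal]
  linear_combination ((√(cA k a) : ℝ) * (cA k a * b - k * (conj a * conj b) * conj a) : ℂ) * eB

end

/-! ### The twist as a smooth map of `R4` -/

/-- The map of the sphere to itself that makes the leaves of `S_{p,q}`, for
`k = (q - p) / (2 (p + q))`, tangent to the kernel of `Re (z₁ dz₂ - z₂ dz₁)`; see
`hasDerivAt_twist`. For `k = 0` it is the identity. -/
noncomputable def twist (k : ℝ) (z : R4) : R4 :=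
  ofPair (twist₁ k (z₁ z) (z₂ z)) (twist₂ k (z₁ z) (z₂ z))

/-- A left inverse of `twist k` on the sphere, smooth near the image of the sphere. -/
noncomputable def untwist (k : ℝ) (z : R4) : R4 :=
  ofPair (untwist₁ k (z₁ z) (z₂ z)) (untwist₂ k (z₁ z) (z₂ z))

theorem untwist_twist {k : ℝ} (hk : |k| < 1 / 2) (x : S3) : untwist k (twist k x) = x := by
  have h := normSq_add_normSq x
  rw [untwist, twist, z₁_ofPair, z₂_ofPair, untwist₁_twist hk h, untwist₂_twist hk h, ofPair_z]

theorem norm_twist {k : ℝ} (hk : |k| < 1 / 2) (x : S3) : ‖twist k x‖ = 1 := by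
  have h := normSq_twist_add hk (normSq_add_normSq x)
  have h2 := norm_sq_eq (twist k x)
  rw [twist, z₁_ofPair, z₂_ofPair, h] at h2
  rw [← twist] at h2
  nlinarith [norm_nonneg (twist k x)]

theorem contDiffAt_twist {n : WithTop ℕ∞} {k : ℝ} (hk : |k| < 1 / 2) (x : S3) :
    ContDiffAt ℝ n (fun q : ℝ × R4 => twist q.1 q.2) (k, (x : R4)) := by
  have h := normSq_add_normSq x
  have cz₁ : ContDiff ℝ n fun q : ℝ × R4 => z₁ q.2 := contDiff_z₁.comp contDiff_snd
  have cz₂ : ContDiff ℝ n fun q : ℝ × R4 => z₂ q.2 := contDiff_z₂.comp contDiff_snd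
  have cn₁ : ContDiff ℝ n fun q : ℝ × R4 => Complex.normSq (z₁ q.2) := contDiff_normSq.comp cz₁
  have cn₂ : ContDiff ℝ n fun q : ℝ × R4 => Complex.normSq (z₂ q.2) := contDiff_normSq.comp cz₂
  have ccA : ContDiff ℝ n fun q : ℝ × R4 => cA q.1 (z₁ q.2) := by unfold cA; fun_prop
  have ccB : ContDiff ℝ n fun q : ℝ × R4 => cB q.1 (z₂ q.2) := by unfold cB; fun_prop
  have cV : ContDiff ℝ n fun q : ℝ × R4 => vel q.1 (normSqSub (z₁ q.2) (z₂ q.2)) := by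
    unfold vel normSqSub; fun_prop
  have ck : ContDiff ℝ n fun q : ℝ × R4 => (q.1 : ℂ) := contDiff_ofReal.comp contDiff_fst
  have ccA' : ContDiff ℝ n fun q : ℝ × R4 => (cA q.1 (z₁ q.2) : ℂ) := contDiff_ofReal.comp ccA
  have ccB' : ContDiff ℝ n fun q : ℝ × R4 => (cB q.1 (z₂ q.2) : ℂ) := contDiff_ofReal.comp ccB
  have cAB : ContDiff ℝ n fun q : ℝ × R4 => ((cA q.1 (z₁ q.2) * cB q.1 (z₂ q.2) : ℝ) : ℂ) :=
    contDiff_ofReal.comp (ccA.mul ccB)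
  have cz₁' : ContDiff ℝ n fun q : ℝ × R4 => conj (z₁ q.2) := contDiff_conj.comp cz₁
  have cz₂' : ContDiff ℝ n fun q : ℝ × R4 => conj (z₂ q.2) := contDiff_conj.comp cz₂
  have cu' : ContDiff ℝ n fun q : ℝ × R4 => conj (z₁ q.2 * z₂ q.2) :=
    contDiff_conj.comp (cz₁.mul cz₂)
  have cD : ContDiff ℝ n fun q : ℝ × R4 => disc q.1 (z₁ q.2) (z₂ q.2) := by
    unfold disc; fun_prop
  have cH : ContDiffAt ℝ n (fun q : ℝ × R4 => halfPhase (disc q.1 (z₁ q.2) (z₂ q.2)))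
      (k, (x : R4)) :=
    ContDiffAt.comp (k, (x : R4)) (f := fun q : ℝ × R4 => disc q.1 (z₁ q.2) (z₂ q.2))
      (contDiffAt_halfPhase (disc_re_pos hk h)) cD.contDiffAt
  have cp₁ : ContDiff ℝ n fun q : ℝ × R4 => pre₁ q.1 (z₁ q.2) (z₂ q.2) := by
    unfold pre₁; fun_prop
  have cp₂ : ContDiff ℝ n fun q : ℝ × R4 => pre₂ q.1 (z₁ q.2) (z₂ q.2) := by
    unfold pre₂; fun_prop
  have sA : ContDiffAt ℝ n (fun q : ℝ × R4 => ((√(cA q.1 (z₁ q.2)) : ℝ) : ℂ)) (k, (x : R4)) :=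
    contDiff_ofReal.contDiffAt.comp _ (ccA.contDiffAt.sqrt (cA_pos hk h).ne')
  have sB : ContDiffAt ℝ n (fun q : ℝ × R4 => ((√(cB q.1 (z₂ q.2)) : ℝ) : ℂ)) (k, (x : R4)) :=
    contDiff_ofReal.contDiffAt.comp _ (ccB.contDiffAt.sqrt (cB_pos hk h).ne')
  have sV : ContDiffAt ℝ n (fun q : ℝ × R4 => ((√(vel q.1 (normSqSub (z₁ q.2) (z₂ q.2))) : ℝ) : ℂ)⁻¹)
      (k, (x : R4)) :=
    (contDiff_ofReal.contDiffAt.comp _ (cV.contDiffAt.sqrt (vel_pos hk h).ne')).inv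
      (by simpa using (Real.sqrt_pos.2 (vel_pos hk h)).ne')
  unfold twist twist₁ twist₂
  simp only [div_eq_mul_inv]
  exact ContDiffAt.ofPair ((cH.mul (sA.mul cp₁.contDiffAt)).mul sV)
    ((cH.mul (sB.mul cp₂.contDiffAt)).mul sV)

theorem contDiffAt_untwist {n : WithTop ℕ∞} {k : ℝ} (hk : |k| < 1 / 2) (x : S3) :
    ContDiffAt ℝ n (untwist k) (twist k x) := by
  have h := normSq_add_normSq x
  have hA := cA_pos hk h
  have hB := cB_pos hk h
  have hV := vel_pos hk h
  set y := twist k x with hy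
  have y₁ : z₁ y = twist₁ k (z₁ x) (z₂ x) := by rw [hy, twist, z₁_ofPair]
  have y₂ : z₂ y = twist₂ k (z₁ x) (z₂ x) := by rw [hy, twist, z₂_ofPair]
  have cu : ContDiff ℝ n fun q : R4 => z₁ q * z₂ q := by fun_prop
  have cdiff : ContDiff ℝ n fun q : R4 => normSqSub (z₁ q) (z₂ q) := by
    unfold normSqSub
    exact (contDiff_normSq.comp contDiff_z₁).sub (contDiff_normSq.comp contDiff_z₂)
  have ceq : ContDiff ℝ n fun q : R4 => imSq (z₁ q) (z₂ q) := by
    simp only [imSq_eq]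
    exact contDiff_const.mul ((contDiff_im.comp cu).pow 2)
  have cL : ContDiffAt ℝ n (fun q : R4 => srcLevel k (z₁ q) (z₂ q)) y := by
    have h1 := (contDiffAt_level (admissible_twist hk h)).1
    rw [height_twist hk h, ← y₁, ← y₂] at h1
    exact (h1.of_le le_top).comp y (f := fun q : R4 => (normSqSub (z₁ q) (z₂ q), imSq (z₁ q) (z₂ q)))
      (cdiff.prodMk ceq).contDiffAt
  have eL : srcLevel k (z₁ y) (z₂ y) = normSqSub (z₁ x) (z₂ x) := by
    rw [y₁, y₂, srcLevel_twist hk h]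
  have eQ : srcQ k (z₁ y) (z₂ y) = cA k (z₁ x) * cB k (z₂ x) := by
    rw [y₁, y₂, srcQ_twist hk h]
  have hE := (admissible_twist hk h).ecc_pos
  have hEW := (admissible_twist hk h).ecc_lt
  have eW : srcW k (z₁ y) (z₂ y) = vel k (normSqSub (z₁ x) (z₂ x)) ^ 2 + (1 - k ^ 2) := by
    rw [srcW, eL]
  rw [← y₁, ← y₂] at hE hEW
  rw [← eW] at hEW
  have cV : ContDiffAt ℝ n (fun q : R4 => vel k (srcLevel k (z₁ q) (z₂ q))) y := by
    unfold vel; fun_prop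
  have cQ : ContDiffAt ℝ n (fun q : R4 => srcQ k (z₁ q) (z₂ q)) y := by
    unfold srcQ; fun_prop
  have cW : ContDiffAt ℝ n (fun q : R4 => srcW k (z₁ q) (z₂ q)) y := by
    unfold srcW; fun_prop
  have cE : ContDiffAt ℝ n (fun q : R4 => ecc k (imSq (z₁ q) (z₂ q))) y := by
    unfold ecc
    exact contDiffAt_const.sub (contDiffAt_const.mul ceq.contDiffAt)
  have sE := cE.sqrt hE.ne'
  have sQ := cQ.sqrt (by rw [eQ]; positivity)
  have sV := cV.sqrt (by rw [eL]; positivity)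
  have hsE := Real.sqrt_pos.2 hE
  have hsQ : 0 < √(srcQ k (z₁ y) (z₂ y)) := Real.sqrt_pos.2 (by rw [eQ]; positivity)
  have cre := contDiff_re.contDiffAt.comp y cu.contDiffAt
  have cim := contDiff_im.contDiffAt.comp y cu.contDiffAt
  have cM : ContDiffAt ℝ n (fun q : R4 => srcMul k (z₁ q) (z₂ q)) y := by
    have m1 := (cre.mul (cV.mul sE)).div (sQ.mul (cW.sub cE))
      (mul_ne_zero hsQ.ne' (sub_pos.2 hEW).ne')
    have m2 := (cim.mul cW).div ((contDiffAt_const (c := (2 : ℝ))).mul sQ |>.mul sE)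
      (by positivity)
    exact (contDiff_ofReal.contDiffAt.comp y m1).add
      ((contDiff_ofReal.contDiffAt.comp y m2).mul contDiffAt_const)
  have cQ' : ContDiffAt ℝ n (fun q : R4 => (srcQ k (z₁ q) (z₂ q) : ℂ)) y :=
    contDiff_ofReal.contDiffAt.comp y cQ
  have cD : ContDiffAt ℝ n (fun q : R4 => srcDisc k (z₁ q) (z₂ q)) y := by
    unfold srcDisc; fun_prop
  have eD : srcDisc k (z₁ y) (z₂ y) = disc k (z₁ x) (z₂ x) := by
    rw [y₁, y₂, srcDisc_twist hk h]
  have cH : ContDiffAt ℝ n (fun q : R4 => halfPhase (srcDisc k (z₁ q) (z₂ q))) y :=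
    ContDiffAt.comp y (f := fun q : R4 => srcDisc k (z₁ q) (z₂ q))
      (contDiffAt_halfPhase (by rw [eD]; exact disc_re_pos hk h)) cD
  have cP : ContDiffAt ℝ n (fun q : R4 => srcPhase k (z₁ q) (z₂ q)) y :=
    (contDiff_conj.contDiffAt.comp y cH).mul (contDiff_ofReal.contDiffAt.comp y sV)
  have sQ' := contDiff_ofReal.contDiffAt.comp y sQ
  have cM' := contDiff_conj.contDiffAt.comp y cM
  have cP₁ := cP.mul (contDiff_z₁ (n := n)).contDiffAt
  have cP₂ := cP.mul (contDiff_z₂ (n := n)).contDiffAt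
  have e1 : 1 + k * ((1 - normSqSub (z₁ x) (z₂ x)) / 2) = cB k (z₂ x) := by
    have hb : Complex.normSq (z₁ x) = 1 - Complex.normSq (z₂ x) := by linarith
    unfold cB normSqSub; rw [hb]; ring
  have e2 : 1 - k * ((1 + normSqSub (z₁ x) (z₂ x)) / 2) = cA k (z₁ x) := by
    have hb : Complex.normSq (z₂ x) = 1 - Complex.normSq (z₁ x) := by linarith
    unfold cA normSqSub; rw [hb]; ring
  have d1 : ContDiffAt ℝ n (fun q : R4 => ((vel k (srcLevel k (z₁ q) (z₂ q))
      * √(1 + k * ((1 - srcLevel k (z₁ q) (z₂ q)) / 2)))⁻¹ : ℝ)) y := by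
    refine (cV.mul (ContDiffAt.sqrt (by fun_prop) ?_)).inv ?_
    · rw [eL, e1]; exact hB.ne'
    · rw [eL, e1]; positivity
  have d2 : ContDiffAt ℝ n (fun q : R4 => ((vel k (srcLevel k (z₁ q) (z₂ q))
      * √(1 - k * ((1 + srcLevel k (z₁ q) (z₂ q)) / 2)))⁻¹ : ℝ)) y := by
    refine (cV.mul (ContDiffAt.sqrt (by fun_prop) ?_)).inv ?_
    · rw [eL, e2]; exact hA.ne'
    · rw [eL, e2]; positivity
  exact ContDiffAt.ofPair
    (((sQ'.mul cP₁).sub ((contDiffAt_const.mul cM').mul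
      (contDiff_conj.contDiffAt.comp y cP₂))).mul (contDiff_ofReal.contDiffAt.comp y d1))
    (((sQ'.mul cP₂).add ((contDiffAt_const.mul cM').mul
      (contDiff_conj.contDiffAt.comp y cP₁))).mul (contDiff_ofReal.contDiffAt.comp y d2))

/-! ### Diffeomorphisms of the sphere -/

/-- The extension of a map of the sphere to `R4` that is homogeneous of degree one. -/
noncomputable def homExt (F : R4 → R4) (y : R4) : R4 := ‖y‖ • F (‖y‖⁻¹ • y)

theorem contDiffAt_homExt {F : R4 → R4} {x : S3} (hF : ContDiffAt ℝ 1 F x) :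
    ContDiffAt ℝ 1 (homExt F) x := by
  have hx : (x : R4) ≠ 0 := ne_zero_of_mem_unit_sphere x
  have hn : ContDiffAt ℝ 1 (fun y : R4 => ‖y‖) (x : R4) := contDiffAt_norm ℝ hx
  refine hn.smul (ContDiffAt.comp (x : R4) (f := fun y : R4 => ‖y‖⁻¹ • y) ?_
    ((hn.inv (norm_ne_zero_iff.2 hx)).smul contDiffAt_id))
  simpa using hF

/-- A smooth self-map of the sphere with a smooth left inverse is onto: it is open, since its
homogeneous extension has an injective, hence bijective, derivative, and the sphere is compact and
connected. -/
theorem surjective_of_leftInverse {f : S3 → S3} {F G : R4 → R4} (hf : ∀ x : S3, F x = f x)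
    (hF : ∀ x : S3, ContDiffAt ℝ 1 F x) (hG : ∀ x : S3, ContDiffAt ℝ 1 G (f x))
    (hGF : ∀ x : S3, G (f x) = x) : Function.Surjective f := by
  have hcont : Continuous f := by
    refine continuous_induced_rng.2 (continuous_iff_continuousAt.2 fun x => ?_)
    have : (Subtype.val ∘ f) = fun x : S3 => F x := funext fun x => (hf x).symm
    rw [this]
    exact (hF x).continuousAt.comp continuous_subtype_val.continuousAt
  have hunit : ∀ y : R4, y ≠ 0 → ∃ x : S3, (x : R4) = ‖y‖⁻¹ • y := fun y hy =>
    ⟨⟨‖y‖⁻¹ • y, by simp [norm_smul, hy]⟩, rfl⟩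
  have hnorm : ∀ y : R4, y ≠ 0 → ‖homExt F y‖ = ‖y‖ := by
    intro y hy
    obtain ⟨x, hx⟩ := hunit y hy
    rw [homExt, ← hx, hf, norm_smul, norm_eq_of_mem_sphere (f x), norm_norm, mul_one]
  have hleft : ∀ y : R4, y ≠ 0 → homExt G (homExt F y) = y := by
    intro y hy
    have hy' : ‖y‖ ≠ 0 := norm_ne_zero_iff.2 hy
    obtain ⟨x, hx⟩ := hunit y hy
    rw [homExt, hnorm y hy, homExt, ← hx, hf, smul_smul, inv_mul_cancel₀ hy', one_smul, hGF, hx,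
      smul_smul, mul_inv_cancel₀ hy', one_smul]
  have hon : ∀ x : S3, homExt F x = f x := fun x => by simp [homExt, hf]
  have hopen : IsOpen (Set.range f) := by
    rw [isOpen_iff_mem_nhds]
    rintro _ ⟨x, rfl⟩
    have hx0 : (x : R4) ≠ 0 := ne_zero_of_mem_unit_sphere x
    have h1 := (contDiffAt_homExt (hF x)).hasStrictFDerivAt one_ne_zero
    have h2 := ((contDiffAt_homExt (hG x)).differentiableAt one_ne_zero).hasFDerivAt
    rw [← hon x] at h2
    have h3 := (h2.comp (x : R4) h1.hasFDerivAt).unique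
      ((hasFDerivAt_id (x : R4)).congr_of_eventuallyEq (by
        filter_upwards [isOpen_ne.mem_nhds hx0] with y hy using hleft y hy))
    have hinj : Function.Injective (fderiv ℝ (homExt F) (x : R4)) := by
      intro v w hvw
      have e1 := DFunLike.congr_fun h3 v
      have e2 := DFunLike.congr_fun h3 w
      simp only [ContinuousLinearMap.comp_apply, hvw, ContinuousLinearMap.id_apply] at e1 e2
      rw [← e1, e2]
    have hsurj : (fderiv ℝ (homExt F) (x : R4)).range = ⊤ :=
      LinearMap.range_eq_top.2 (LinearMap.injective_iff_surjective.1 hinj)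
    have h4 := h1.map_nhds_eq_of_surj hsurj
    have h5 : homExt F '' {y | y ≠ 0} ∈ nhds ((f x : S3) : R4) := by
      rw [← hon x, ← h4]
      exact Filter.image_mem_map (isOpen_ne.mem_nhds hx0)
    have h6 := continuous_subtype_val.continuousAt.preimage_mem_nhds h5
    filter_upwards [h6] with w hw
    obtain ⟨y, hy, hyw⟩ := hw
    have hy1 : ‖y‖ = 1 := by
      rw [← hnorm y hy, hyw]; exact norm_eq_of_mem_sphere w
    refine ⟨⟨y, by simpa using hy1⟩, Subtype.ext ?_⟩
    rw [← hyw, ← hon]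
  have hclosed : IsClosed (Set.range f) := (isCompact_range hcont).isClosed
  have : PreconnectedSpace S3 := Subtype.preconnectedSpace
    (isPreconnected_sphere (by
      rw [rank_eq_card_basis (EuclideanSpace.basisFun (Fin 4) ℝ).toBasis]; norm_num) 0 1)
  have hne : (Set.range f).Nonempty :=
    ⟨f ⟨EuclideanSpace.single 0 1, by simp⟩, _, rfl⟩
  exact Set.range_eq_univ.1 (IsClopen.eq_univ ⟨hclosed, hopen⟩ hne)

/-- The diffeomorphism of the sphere given by ambient maps `F` and `G`, smooth near the sphere,
where `G` inverts `F` from the left. -/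
noncomputable def diffeoOfAmbient (F G : R4 → R4) (hFn : ∀ x : S3, ‖F x‖ = 1)
    (hF : ∀ x : S3, ContDiffAt ℝ ∞ F x) (hG : ∀ x : S3, ContDiffAt ℝ ∞ G (F x))
    (hGF : ∀ x : S3, G (F x) = x) : Diffeomorph (𝓡 3) (𝓡 3) S3 S3 ∞ :=
  have hsurj : Function.Surjective fun x : S3 => (⟨F x, by simp [hFn]⟩ : S3) :=
    surjective_of_leftInverse (F := F) (G := G) (fun _ => rfl)
      (fun x => (hF x).of_le (by simp)) (fun x => (hG x).of_le (by simp)) hGF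
  have hGn : ∀ y : S3, G y ∈ Metric.sphere (0 : R4) 1 := fun y => by
    obtain ⟨x, rfl⟩ := hsurj y
    simp [hGF]
  { toFun := fun x => ⟨F x, by simp [hFn]⟩
    invFun := fun y => ⟨G y, hGn y⟩
    left_inv := fun x => Subtype.ext (hGF x)
    right_inv := fun y => by
      obtain ⟨x, rfl⟩ := hsurj y
      exact Subtype.ext (by simp only [hGF])
    contMDiff_toFun := ContMDiff.codRestrict_sphere
      (fun x => (hF x).contMDiffAt.comp x (contMDiff_coe_sphere x)) _
    contMDiff_invFun := ContMDiff.codRestrict_sphere (f := fun y : S3 => G y)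
      (fun y => by
        have hy : ContDiffAt ℝ ∞ G y := by
          obtain ⟨x, rfl⟩ := hsurj y
          exact hG x
        exact hy.contMDiffAt.comp y (contMDiff_coe_sphere y)) hGn }

/-! ### The isotopy -/

/-- The map `c + s A` with `A z = (i z₁ - z̄₂, i z₂ + z̄₁)`. As `A` is `√2` times a rotation and is
skew-symmetric, this is a rotation for `c² + 2 s² = 1`. -/
noncomputable def rot (c s : ℝ) (z : R4) : R4 :=
  ofPair (c * z₁ z + s * (Complex.I * z₁ z - conj (z₂ z)))
    (c * z₂ z + s * (Complex.I * z₂ z + conj (z₁ z)))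

theorem rot_neg_rot {c s : ℝ} (h : c ^ 2 + 2 * s ^ 2 = 1) (z : R4) : rot c (-s) (rot c s z) = z := by
  have h' : (c : ℂ) ^ 2 + 2 * s ^ 2 = 1 := by exact_mod_cast congrArg Complex.ofReal h
  apply ext_z
  · simp only [rot, z₁_ofPair, z₂_ofPair, map_add, map_mul, Complex.conj_ofReal, Complex.conj_I,
      Complex.conj_conj]
    push_cast
    linear_combination z₁ z * h' - s ^ 2 * z₁ z * Complex.I_sq
  · simp only [rot, z₁_ofPair, z₂_ofPair, map_sub, map_add, map_mul, Complex.conj_ofReal,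
      Complex.conj_I, Complex.conj_conj]
    push_cast
    linear_combination z₂ z * h' - s ^ 2 * z₂ z * Complex.I_sq

theorem norm_rot {c s : ℝ} (h : c ^ 2 + 2 * s ^ 2 = 1) (z : R4) : ‖rot c s z‖ = ‖z‖ := by
  rw [← sq_eq_sq₀ (norm_nonneg _) (norm_nonneg _), norm_sq_eq, norm_sq_eq]
  simp only [rot, z₁_ofPair, z₂_ofPair, Complex.normSq_apply]
  simp
  linear_combination ((z₁ z).re ^ 2 + (z₁ z).im ^ 2 + (z₂ z).re ^ 2 + (z₂ z).im ^ 2) * h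

theorem contDiff_rot {n : WithTop ℕ∞} :
    ContDiff ℝ n fun q : ℝ × ℝ × R4 => rot q.1 q.2.1 q.2.2 := by
  have cz₁ : ContDiff ℝ n fun q : ℝ × ℝ × R4 => z₁ q.2.2 :=
    contDiff_z₁.comp (contDiff_snd.comp contDiff_snd)
  have cz₂ : ContDiff ℝ n fun q : ℝ × ℝ × R4 => z₂ q.2.2 :=
    contDiff_z₂.comp (contDiff_snd.comp contDiff_snd)
  have c1 : ContDiff ℝ n fun q : ℝ × ℝ × R4 => (q.1 : ℂ) := contDiff_ofReal.comp contDiff_fst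
  have c2 : ContDiff ℝ n fun q : ℝ × ℝ × R4 => (q.2.1 : ℂ) :=
    contDiff_ofReal.comp (contDiff_fst.comp contDiff_snd)
  have cz₁' := (contDiff_conj (n := n)).comp cz₁
  have cz₂' := (contDiff_conj (n := n)).comp cz₂
  exact ofPairL.contDiff.comp
    (((c1.mul cz₁).add (c2.mul ((contDiff_const.mul cz₁).sub cz₂'))).prodMk
    ((c1.mul cz₂).add (c2.mul ((contDiff_const.mul cz₂).add cz₁'))))

/-- The parameter of the twist at time `τ` of the isotopy, from `0` at `τ = 0` to `k` at `τ = 1`. -/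
noncomputable def moveParam (k τ : ℝ) : ℝ := Real.sin (Real.pi / 2 * τ) * k

theorem abs_moveParam_lt {k : ℝ} (hk : |k| < 1 / 2) (τ : ℝ) : |moveParam k τ| < 1 / 2 := by
  rw [moveParam, abs_mul]
  exact (mul_le_of_le_one_left (abs_nonneg k) (Real.abs_sin_le_one _)).trans_lt hk

theorem cos_sq_add_two_mul (θ : ℝ) : Real.cos θ ^ 2 + 2 * (Real.sin θ / √2) ^ 2 = 1 := by
  rw [div_pow, Real.sq_sqrt zero_le_two]; linarith [Real.sin_sq_add_cos_sq θ]

/-- The isotopy at time `τ`, as an ambient map: the twist, followed by a rotation. -/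
noncomputable def moveMap (k τ : ℝ) (z : R4) : R4 :=
  rot (Real.cos (Real.pi / 2 * τ)) (Real.sin (Real.pi / 2 * τ) / √2) (twist (moveParam k τ) z)

/-- A left inverse of `moveMap k τ` on the sphere. -/
noncomputable def moveInv (k τ : ℝ) (z : R4) : R4 :=
  untwist (moveParam k τ)
    (rot (Real.cos (Real.pi / 2 * τ)) (-(Real.sin (Real.pi / 2 * τ) / √2)) z)

theorem contDiffAt_moveMap {k : ℝ} (hk : |k| < 1 / 2) (τ : ℝ) (x : S3) :
    ContDiffAt ℝ ∞ (fun q : ℝ × R4 => moveMap k q.1 q.2) (τ, (x : R4)) := by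
  have h1 : ContDiffAt ℝ ∞ (fun q : ℝ × R4 => twist (moveParam k q.1) q.2) (τ, (x : R4)) :=
    ContDiffAt.comp (τ, (x : R4)) (f := fun q : ℝ × R4 => (moveParam k q.1, q.2))
      (contDiffAt_twist (abs_moveParam_lt hk τ) x) (by unfold moveParam; fun_prop)
  have hc : ContDiff ℝ ∞ fun q : ℝ × R4 => Real.cos (Real.pi / 2 * q.1) :=
    Real.contDiff_cos.comp (by fun_prop)
  have hs : ContDiff ℝ ∞ fun q : ℝ × R4 => Real.sin (Real.pi / 2 * q.1) / √2 :=
    (Real.contDiff_sin.comp (by fun_prop)).div_const _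
  exact contDiff_rot.contDiffAt.comp (τ, (x : R4))
    (hc.contDiffAt.prodMk (hs.contDiffAt.prodMk h1))

theorem contDiffAt_moveInv {k : ℝ} (hk : |k| < 1 / 2) (τ : ℝ) (x : S3) :
    ContDiffAt ℝ ∞ (moveInv k τ) (moveMap k τ x) := by
  have h1 : ContDiff ℝ ∞
      (rot (Real.cos (Real.pi / 2 * τ)) (-(Real.sin (Real.pi / 2 * τ) / √2))) :=
    contDiff_rot.comp (contDiff_const.prodMk (contDiff_const.prodMk contDiff_id))
  refine ContDiffAt.comp (moveMap k τ x) ?_ h1.contDiffAt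
  rw [moveMap, rot_neg_rot (cos_sq_add_two_mul _)]
  exact contDiffAt_untwist (abs_moveParam_lt hk τ) x

theorem moveInv_moveMap {k : ℝ} (hk : |k| < 1 / 2) (τ : ℝ) (x : S3) :
    moveInv k τ (moveMap k τ x) = x := by
  rw [moveInv, moveMap, rot_neg_rot (cos_sq_add_two_mul _),
    untwist_twist (abs_moveParam_lt hk τ)]

theorem norm_moveMap {k : ℝ} (hk : |k| < 1 / 2) (τ : ℝ) (x : S3) : ‖moveMap k τ x‖ = 1 := by
  rw [moveMap, norm_rot (cos_sq_add_two_mul _), norm_twist (abs_moveParam_lt hk τ)]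

/-- The isotopy of diffeomorphisms of the sphere given by `moveMap`. -/
noncomputable def move {k : ℝ} (hk : |k| < 1 / 2) (τ : ℝ) : Diffeomorph (𝓡 3) (𝓡 3) S3 S3 ∞ :=
  diffeoOfAmbient (moveMap k τ) (moveInv k τ) (norm_moveMap hk τ)
    (fun x => (contDiffAt_moveMap hk τ x).comp (x : R4) (f := fun y => (τ, y)) (by fun_prop))
    (contDiffAt_moveInv hk τ) (moveInv_moveMap hk τ)

theorem coe_move {k : ℝ} (hk : |k| < 1 / 2) (τ : ℝ) (x : S3) :
    (move hk τ x : R4) = moveMap k τ x := rfl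

theorem twist_zero (x : S3) : twist 0 x = x := by
  have h : halfPhase 1 = 1 := by norm_num [halfPhase]
  rw [twist]
  conv_rhs => rw [← ofPair_z (x : R4)]
  congr 1 <;> simp [twist₁, twist₂, pre₁, pre₂, cA, cB, disc, vel, h]

theorem isIsotopy_move {k : ℝ} (hk : |k| < 1 / 2) : IsIsotopy (move hk) := by
  constructor
  · intro x
    apply Subtype.ext
    rw [coe_move, moveMap, moveParam]
    simp only [mul_zero, Real.sin_zero, Real.cos_zero, zero_mul, zero_div, twist_zero]
    simp [rot]
  · apply ContMDiff.contMDiffOn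
    refine ContMDiff.codRestrict_sphere (f := fun a : ℝ × S3 => moveMap k a.1 a.2) ?_
      (fun a => by simp [norm_moveMap hk])
    intro a
    refine ContMDiffAt.comp a (f := fun a : ℝ × S3 => (a.1, (a.2 : R4)))
      (contDiffAt_moveMap hk a.1 a.2).contMDiffAt ?_
    exact contMDiffAt_fst.prodMk_space ((contMDiff_coe_sphere a.2).comp a contMDiffAt_snd)

/-! ### Orbits as images of curves -/

theorem exists_lipschitzOnWith_sphere {F : R4 → R4} (hF : ∀ x : S3, ContDiffAt ℝ 1 F x) :
    ∃ K, LipschitzOnWith K F (Metric.sphere (0 : R4) 1) := by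
  apply LocallyLipschitzOn.exists_lipschitzOnWith_of_compact (isCompact_sphere _ _)
  intro x hx
  obtain ⟨K, t, ht, hL⟩ := (hF ⟨x, hx⟩).exists_lipschitzOnWith
  exact ⟨K, t, mem_nhdsWithin_of_mem_nhds ht, hL⟩

/-- The curve is reparametrized by the inverse of `∫ g`, and uniqueness of integral curves
applies. The lower bound on `g` makes the new parameter run through all of `ℝ`. -/
theorem orbit_eq_range_of_pos {X : S3 → R4} {F : R4 → R4} (hX : ∀ x : S3, X x = F x)
    (hF : ∀ x : S3, ContDiffAt ℝ 1 F x) {c : ℝ → S3} {g : ℝ → ℝ} (hg : Continuous g)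
    {δ : ℝ} (hδ : 0 < δ) (hgδ : ∀ s, δ ≤ g s)
    (hc : ∀ s, HasDerivAt (fun s => (c s : R4)) (g s • X (c s)) s) :
    orbit X (c 0) = Set.range c := by
  set T : ℝ → ℝ := fun s => ∫ r in (0 : ℝ)..s, g r with hT
  have hTd : ∀ s, HasDerivAt T (g s) s := fun s => hg.integral_hasStrictDerivAt 0 s |>.hasDerivAt
  have hTc : Continuous T := continuous_iff_continuousAt.2 fun s => (hTd s).continuousAt
  have hTmono : StrictMono T := strictMono_of_deriv_pos fun s => by
    rw [(hTd s).deriv]; exact hδ.trans_le (hgδ s)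
  have hT0 : T 0 = 0 := by simp [hT]
  have hlin : Monotone fun s => T s - δ * s := by
    have hd : ∀ s, HasDerivAt (fun s => T s - δ * s) (g s - δ) s := fun s => by
      exact ((hTd s).sub ((hasDerivAt_id s).const_mul δ)).congr_deriv (by simp)
    exact monotone_of_deriv_nonneg (fun s => (hd s).differentiableAt) fun s => by
      rw [(hd s).deriv]; linarith [hgδ s]
  have htop : Filter.Tendsto T Filter.atTop Filter.atTop := by
    refine Filter.tendsto_atTop_mono' _ ?_ (Filter.tendsto_id.const_mul_atTop hδ)
    filter_upwards [Filter.eventually_ge_atTop (0 : ℝ)] with s hs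
    have := hlin hs
    simp only [hT0] at this
    simp only [id]; linarith
  have hbot : Filter.Tendsto T Filter.atBot Filter.atBot := by
    refine Filter.tendsto_atBot_mono' _ ?_ (Filter.tendsto_id.const_mul_atBot hδ)
    filter_upwards [Filter.eventually_le_atBot (0 : ℝ)] with s hs
    have := hlin hs
    simp only [hT0] at this
    simp only [id]; linarith
  have hTs : Function.Surjective T := hTc.surjective htop hbot
  let e : ℝ ≃o ℝ := hTmono.orderIsoOfSurjective T hTs
  have he : ∀ s, e s = T s := fun s => rfl
  have hinv : ∀ t, HasDerivAt e.symm (g (e.symm t))⁻¹ t := fun t =>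
    HasDerivAt.of_local_left_inverse e.symm.continuous.continuousAt (hTd (e.symm t))
      (hδ.trans_le (hgδ _)).ne' (.of_forall fun y => by rw [← he]; exact e.apply_symm_apply y)
  set γ : ℝ → S3 := fun t => c (e.symm t) with hγ
  have hγ0 : γ 0 = c 0 := by
    change c (e.symm 0) = c 0
    rw [show e.symm 0 = 0 from by rw [OrderIso.symm_apply_eq, he, hT0]]
  have hγd : ∀ t, HasDerivAt (fun s => (γ s : R4)) (X (γ t)) t := fun t => by
    have h1 := (hc (e.symm t)).scomp t (hinv t)
    rwa [smul_smul, inv_mul_cancel₀ (hδ.trans_le (hgδ _)).ne', one_smul] at h1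
  obtain ⟨K, hK⟩ := exists_lipschitzOnWith_sphere hF
  ext y
  constructor
  · rintro ⟨γ', h0, hd, t, rfl⟩
    have := ODE_solution_unique_univ (v := fun _ => F) (s := fun _ => Metric.sphere (0 : R4) 1)
      (f := fun s => (γ' s : R4)) (g := fun s => (γ s : R4)) (t₀ := 0) (K := K) (fun _ => hK)
      (fun s => ⟨by rw [← hX]; exact hd s, (γ' s).2⟩)
      (fun s => ⟨by rw [← hX]; exact hγd s, (γ s).2⟩) (by simp [h0, hγ0])
    exact ⟨e.symm t, Subtype.ext (congrFun this t).symm⟩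
  · rintro ⟨s, rfl⟩
    exact ⟨γ, hγ0, hγd, e s, by simp [hγ]⟩

/-- A curve on the sphere whose velocity is a nonzero periodic multiple of a vector field runs
through a whole orbit of the field. -/
theorem orbit_eq_range {X : S3 → R4} {F : R4 → R4} (hX : ∀ x : S3, X x = F x)
    (hF : ∀ x : S3, ContDiffAt ℝ 1 F x) {c : ℝ → S3} {g : ℝ → ℝ} (hg : Continuous g)
    (hg0 : ∀ s, g s ≠ 0) {P : ℝ} (hP : 0 < P) (hper : Function.Periodic g P)
    (hc : ∀ s, HasDerivAt (fun s => (c s : R4)) (g s • X (c s)) s) :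
    orbit X (c 0) = Set.range c := by
  obtain ⟨s₀, -, hs₀⟩ := isCompact_Icc.exists_isMinOn (Set.nonempty_Icc.2 hP.le)
    (hg.abs.continuousOn (s := Set.Icc 0 P))
  have hδ : ∀ s, |g s₀| ≤ |g s| := fun s => by
    obtain ⟨r, hr, e⟩ := hper.exists_mem_Ico₀ hP s
    rw [e]
    exact hs₀ (Set.Ico_subset_Icc_self hr)
  have hδ0 : 0 < |g s₀| := abs_pos.2 (hg0 _)
  have hsign : (∀ s, 0 < g s) ∨ ∀ s, g s < 0 := by
    by_contra! h
    obtain ⟨⟨s₁, h1⟩, s₂, h2⟩ := h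
    obtain ⟨s, hs⟩ := mem_range_of_exists_le_of_exists_ge hg ⟨s₁, h1⟩ ⟨s₂, h2⟩
    exact hg0 s hs
  rcases hsign with h | h
  · exact orbit_eq_range_of_pos hX hF hg hδ0 (fun s => by rw [← abs_of_pos (h s)]; exact hδ s) hc
  · have h1 := orbit_eq_range_of_pos hX hF (c := fun s => c (-s)) (g := fun s => -g (-s))
      (hg.comp continuous_neg).neg hδ0 (fun s => by rw [← abs_of_neg (h (-s))]; exact hδ _)
      (fun s => by
        have := (hc (-s)).scomp s (hasDerivAt_neg s)
        exact this.congr_deriv (by simp))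
    simp only [neg_zero] at h1
    rw [h1]
    exact neg_surjective.range_comp c

/-! ### The leaves -/

/-- A coordinate of a leaf of the Seifert foliation. -/
noncomputable def leafCurve₁ (p : ℕ) (a : ℂ) (s : ℝ) : ℂ := a * Complex.exp (Complex.I * p * s)

theorem hasDerivAt_leafCurve₁ (p : ℕ) (a : ℂ) (s : ℝ) :
    HasDerivAt (leafCurve₁ p a) (Complex.I * p * leafCurve₁ p a s) s := by
  have h1 : HasDerivAt (fun s : ℝ => Complex.I * p * (s : ℂ)) (Complex.I * p) s := by
    simpa using (Complex.ofRealCLM.hasDerivAt (x := s)).const_mul (Complex.I * p)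
  have h2 := (h1.cexp).const_mul a
  refine h2.congr_deriv ?_
  unfold leafCurve₁; ring

theorem normSq_leafCurve₁ (p : ℕ) (a : ℂ) (s : ℝ) :
    Complex.normSq (leafCurve₁ p a s) = Complex.normSq a := by
  have h : ‖Complex.exp (Complex.I * p * s)‖ = 1 := by
    rw [show Complex.I * p * s = ((p * s : ℝ) : ℂ) * Complex.I by push_cast; ring]
    exact Complex.norm_exp_ofReal_mul_I _
  rw [leafCurve₁, map_mul, Complex.normSq_eq_norm_sq (Complex.exp _), h]; simp

/-- The leaf of `S_{p,q}` through `x`, parametrized by `ℝ`. -/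
noncomputable def leafCurve (p q : ℕ) (x : S3) (s : ℝ) : S3 :=
  ⟨ofPair (leafCurve₁ p (z₁ x) s) (leafCurve₁ q (z₂ x) s), by
    have h := norm_sq_eq (ofPair (leafCurve₁ p (z₁ x) s) (leafCurve₁ q (z₂ x) s))
    rw [z₁_ofPair, z₂_ofPair, normSq_leafCurve₁, normSq_leafCurve₁, normSq_add_normSq] at h
    rw [mem_sphere_zero_iff_norm]
    nlinarith [norm_nonneg (ofPair (leafCurve₁ p (z₁ x) s) (leafCurve₁ q (z₂ x) s))]⟩

theorem leafCurve_zero (p q : ℕ) (x : S3) : leafCurve p q x 0 = x := by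
  apply Subtype.ext
  simp [leafCurve, leafCurve₁]

theorem leafCurve₁_periodic (p : ℕ) (a : ℂ) :
    Function.Periodic (leafCurve₁ p a) (2 * Real.pi) := by
  intro s
  rw [leafCurve₁, leafCurve₁]
  congr 1
  rw [Complex.exp_eq_exp_iff_exists_int]
  exact ⟨p, by push_cast; ring⟩

theorem leafCurve_periodic (p q : ℕ) (x : S3) :
    Function.Periodic (leafCurve p q x) (2 * Real.pi) := by
  intro s
  apply Subtype.ext
  simp only [leafCurve]
  rw [leafCurve₁_periodic, leafCurve₁_periodic]

theorem seifertLeaf_eq_range (p q : ℕ) (x : S3) :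
    seifertLeaf p q x = Set.range (leafCurve p q x) := by
  ext y
  constructor
  · rintro ⟨φ, -, h1, h2⟩
    exact ⟨φ, Subtype.ext (ext_z (by rw [h1]; simp [leafCurve, leafCurve₁])
      (by rw [h2]; simp [leafCurve, leafCurve₁]))⟩
  · rintro ⟨s, rfl⟩
    obtain ⟨r, hr, e⟩ := (leafCurve_periodic p q x).exists_mem_Ico₀ Real.two_pi_pos s
    rw [e]
    exact ⟨r, hr, by simp [leafCurve, leafCurve₁], by simp [leafCurve, leafCurve₁]⟩

/-! ### Rotations and the contact form -/

theorem rot_zero_left (σ : ℝ) (y : R4) : rot 0 σ y =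
    ofPair (σ * (Complex.I * z₁ y - conj (z₂ y))) (σ * (Complex.I * z₂ y + conj (z₁ y))) := by
  simp [rot]

/-- The rotation turns the form `Re (z₁ dz₂ - z₂ dz₁)` into a multiple of the standard one. -/
theorem stdContactForm_rot (σ : ℝ) (y v : R4) :
    stdContactForm (rot 0 σ y) (rot 0 σ v) = 2 * σ ^ 2 * (z₁ y * z₂ v - z₂ y * z₁ v).re := by
  rw [stdContactForm_eq, rot_zero_left, rot_zero_left]
  simp
  ring

theorem wronskian_rot_im (σ : ℝ) (y v : R4) :
    (z₁ (rot 0 σ y) * z₂ (rot 0 σ v) - z₂ (rot 0 σ y) * z₁ (rot 0 σ v)).im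
      = -(2 * σ ^ 2 * (z₁ y * z₂ v - z₂ y * z₁ v).im) := by
  rw [rot_zero_left, rot_zero_left]
  simp
  ring

theorem two_mul_rot (y : R4) :
    2 * (z₁ (rot 0 (1 / √2) y) * z₂ (rot 0 (1 / √2) y))
      = ⟨-(2 * (z₁ y * z₂ y).re), normSqSub (z₁ y) (z₂ y)⟩ := by
  have h2 : (1 / √2 : ℝ) * (1 / √2) = 1 / 2 := by
    rw [div_mul_div_comm, Real.mul_self_sqrt zero_le_two]; norm_num
  generalize (1 / √2 : ℝ) = σ at h2
  rw [rot_zero_left]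
  apply Complex.ext
  · simp
    linear_combination (-(4 * ((z₁ y).re * (z₂ y).re - (z₁ y).im * (z₂ y).im))) * h2
  · simp [normSqSub, Complex.normSq_apply]
    linear_combination (2 * ((z₁ y).re ^ 2 + (z₁ y).im ^ 2 - (z₂ y).re ^ 2 - (z₂ y).im ^ 2)) * h2

theorem normSqSub_rot (y : R4) :
    normSqSub (z₁ (rot 0 (1 / √2) y)) (z₂ (rot 0 (1 / √2) y)) = 2 * (z₁ y * z₂ y).im := by
  have h2 : (1 / √2 : ℝ) * (1 / √2) = 1 / 2 := by
    rw [div_mul_div_comm, Real.mul_self_sqrt zero_le_two]; norm_num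
  generalize (1 / √2 : ℝ) = σ at h2
  rw [rot_zero_left]
  simp [normSqSub, Complex.normSq_apply]
  linear_combination (4 * ((z₁ y).re * (z₂ y).im + (z₁ y).im * (z₂ y).re)) * h2

theorem potential_rot {k : ℝ} {y : R4} (h : Complex.normSq (z₁ y) + Complex.normSq (z₂ y) = 1) :
    potential k (2 * (z₁ (rot 0 (1 / √2) y) * z₂ (rot 0 (1 / √2) y)))
      = level k (normSqSub (z₁ y) (z₂ y)) (imSq (z₁ y) (z₂ y)) := by
  rw [two_mul_rot, potential]
  congr 1
  rw [imSq_eq]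
  simp only [normSqSub, Complex.normSq_apply, Complex.mul_re, Complex.mul_im] at h ⊢
  linear_combination -(((z₁ y).re * (z₁ y).re + (z₁ y).im * (z₁ y).im)
    + ((z₂ y).re * (z₂ y).re + (z₂ y).im * (z₂ y).im) + 1) * h

/-! ### The twist makes the leaves Legendrian -/

/-- The two long factors are the derivatives of `pre₂` and `pre₁` along the leaf through `(a, b)`.
By the relation between `k`, `p` and `q`, with `u = a b` and `r = cA k a * cB k b`, the second
factor of the product is a real multiple of `i (r u + (r - k² |u|²) ū - k² ū³)`. The product of
the bracket with `disc k a b = r - k² u²` is real. -/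
theorem re_disc_mul_wronskian {k p q : ℝ} (hk : k * (2 * (p + q)) = q - p) (a b : ℂ) 
    (h : Complex.normSq a + Complex.normSq b = 1) :
    (disc k a b * (pre₁ k a b * (Complex.I * (q * (cA k a * b)
        + (q + 2 * p) * (k * conj (a * b) * conj a)))
      - pre₂ k a b * (Complex.I * (p * (cB k b * a)
        - (p + 2 * q) * (k * conj (a * b) * conj b))))).re = 0 := by
  have hx : Complex.normSq a * Complex.normSq b = Complex.normSq (a * b) := (map_mul _ _ _).symm
  have e1 : (3 * p + q) * (cB k b * Complex.normSq a) + (p + 3 * q) * (cA k a * Complex.normSq b)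
      = 2 * (p + q) * (cA k a * cB k b - k ^ 2 * Complex.normSq (a * b)) := by
    rw [← hx]
    have hb : Complex.normSq b = 1 - Complex.normSq a := by linarith
    unfold cA cB
    rw [hb]
    linear_combination (2 * Complex.normSq a - 1
      + 2 * k * Complex.normSq a * (1 - Complex.normSq a)) * hk
  have e2 : pre₁ k a b * (Complex.I * (q * (cA k a * b)
        + (q + 2 * p) * (k * conj (a * b) * conj a)))
      - pre₂ k a b * (Complex.I * (p * (cB k b * a)
        - (p + 2 * q) * (k * conj (a * b) * conj b))) =
      ((2 * (p + q) * k : ℝ) : ℂ) * (Complex.I * ((cA k a * cB k b : ℝ) * (a * b)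
        + ((cA k a * cB k b - k ^ 2 * Complex.normSq (a * b) : ℝ) : ℂ) * conj (a * b)
        - k ^ 2 * conj (a * b) ^ 3)) := by
    have e1' := congrArg Complex.ofReal e1
    have hk' := congrArg Complex.ofReal hk
    push_cast at e1' hk' ⊢
    rw [← Complex.mul_conj (a * b), ← Complex.mul_conj a, ← Complex.mul_conj b] at e1'
    rw [← Complex.mul_conj (a * b), pre₁, pre₂]
    simp only [map_mul] at e1' ⊢
    linear_combination (Complex.I * k * conj a * conj b) * e1'
      + (- Complex.I * (cA k a * cB k b * (a * b) - k ^ 2 * (conj a * conj b) ^ 3)) * hk'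
  rw [e2, disc]
  generalize cA k a * cB k b = r
  generalize a * b = u
  simp [Complex.normSq_apply, pow_succ]
  ring_nf

section

variable {k : ℝ} {p q : ℕ}

theorem cA_leafCurve₁ (a : ℂ) (s : ℝ) : cA k (leafCurve₁ p a s) = cA k a := by
  rw [cA, cA, normSq_leafCurve₁]

theorem cB_leafCurve₁ (b : ℂ) (s : ℝ) : cB k (leafCurve₁ q b s) = cB k b := by
  rw [cB, cB, normSq_leafCurve₁]

theorem normSqSub_leafCurve₁ (a b : ℂ) (s : ℝ) :
    normSqSub (leafCurve₁ p a s) (leafCurve₁ q b s) = normSqSub a b := by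
  rw [normSqSub, normSqSub, normSq_leafCurve₁, normSq_leafCurve₁]

theorem hasDerivAt_conj_leafCurve₁ (p : ℕ) (a : ℂ) (s : ℝ) :
    HasDerivAt (fun s => conj (leafCurve₁ p a s)) (-(Complex.I * p * conj (leafCurve₁ p a s))) s := by
  refine (Complex.conjCLE.hasFDerivAt.comp_hasDerivAt s (hasDerivAt_leafCurve₁ p a s)).congr_deriv ?_
  simp

theorem hasDerivAt_pre₁ (a b : ℂ) (s : ℝ) :
    HasDerivAt (fun s => pre₁ k (leafCurve₁ p a s) (leafCurve₁ q b s))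
      (Complex.I * (p * (cB k b * leafCurve₁ p a s)
        - (p + 2 * q) * (k * conj (leafCurve₁ p a s * leafCurve₁ q b s)
          * conj (leafCurve₁ q b s)))) s := by
  have h1 := hasDerivAt_leafCurve₁ p a s
  have h2 := hasDerivAt_conj_leafCurve₁ p a s
  have h3 := hasDerivAt_conj_leafCurve₁ q b s
  have h := (h1.const_mul (cB k b : ℂ)).add (((h2.mul h3).const_mul (k : ℂ)).mul h3)
  refine (h.congr_deriv ?_).congr_of_eventuallyEq (.of_forall fun r => ?_)
  · simp only [Pi.mul_apply, map_mul]; ring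
  · simp only [pre₁, cB_leafCurve₁, map_mul, Pi.add_apply, Pi.mul_apply]

theorem hasDerivAt_pre₂ (a b : ℂ) (s : ℝ) :
    HasDerivAt (fun s => pre₂ k (leafCurve₁ p a s) (leafCurve₁ q b s))
      (Complex.I * (q * (cA k a * leafCurve₁ q b s)
        + (q + 2 * p) * (k * conj (leafCurve₁ p a s * leafCurve₁ q b s)
          * conj (leafCurve₁ p a s)))) s := by
  have h1 := hasDerivAt_leafCurve₁ q b s
  have h2 := hasDerivAt_conj_leafCurve₁ p a s
  have h3 := hasDerivAt_conj_leafCurve₁ q b s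
  have h := (h1.const_mul (cA k a : ℂ)).sub (((h2.mul h3).const_mul (k : ℂ)).mul h2)
  refine (h.congr_deriv ?_).congr_of_eventuallyEq (.of_forall fun r => ?_)
  · simp only [Pi.mul_apply, map_mul]; ring
  · simp only [pre₂, cA_leafCurve₁, map_mul, Pi.sub_apply, Pi.mul_apply]

theorem normSq_leafCurve₁_add {a b : ℂ} (h : Complex.normSq a + Complex.normSq b = 1) (s : ℝ) :
    Complex.normSq (leafCurve₁ p a s) + Complex.normSq (leafCurve₁ q b s) = 1 := by
  rwa [normSq_leafCurve₁, normSq_leafCurve₁]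

/-- The twist of a leaf is tangent to the kernel of `Re (z₁ dz₂ - z₂ dz₁)`. The derivative of the
phase factor drops out of the antisymmetric expression, which is multiplied by the square of that
factor, `disc / |disc|`. -/
theorem hasDerivAt_twist (hk : |k| < 1 / 2) (hkpq : k * (2 * (p + q)) = q - p) {a b : ℂ}
    (h : Complex.normSq a + Complex.normSq b = 1) (s : ℝ) :
    ∃ D₁ D₂ : ℂ,
      HasDerivAt (fun s => twist₁ k (leafCurve₁ p a s) (leafCurve₁ q b s)) D₁ s ∧
      HasDerivAt (fun s => twist₂ k (leafCurve₁ p a s) (leafCurve₁ q b s)) D₂ s ∧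
      (twist₁ k (leafCurve₁ p a s) (leafCurve₁ q b s) * D₂
        - twist₂ k (leafCurve₁ p a s) (leafCurve₁ q b s) * D₁).re = 0 := by
  have hs := normSq_leafCurve₁_add (p := p) (q := q) h
  have hC := disc_re_pos hk (hs s)
  have hdisc : DifferentiableAt ℝ (fun s => disc k (leafCurve₁ p a s) (leafCurve₁ q b s)) s := by
    have e : (fun s => disc k (leafCurve₁ p a s) (leafCurve₁ q b s)) = fun s =>
        ((cA k a * cB k b : ℝ) : ℂ) - (k * (leafCurve₁ p a s * leafCurve₁ q b s)) ^ 2 := by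
      funext s; rw [disc, cA_leafCurve₁, cB_leafCurve₁]
    rw [e]
    have d1 := (hasDerivAt_leafCurve₁ p a s).differentiableAt
    have d2 := (hasDerivAt_leafCurve₁ q b s).differentiableAt
    exact (differentiableAt_const _).sub (((d1.mul d2).const_mul _).pow 2)
  obtain ⟨κ', hκ⟩ : ∃ κ', HasDerivAt
      (fun s => halfPhase (disc k (leafCurve₁ p a s) (leafCurve₁ q b s))) κ' s :=
    ⟨_, DifferentiableAt.hasDerivAt (DifferentiableAt.comp s (g := halfPhase)
      ((contDiffAt_halfPhase (n := 1) hC).differentiableAt one_ne_zero) hdisc)⟩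
  have hP₁ := hasDerivAt_pre₁ (k := k) (p := p) (q := q) a b s
  have hP₂ := hasDerivAt_pre₂ (k := k) (p := p) (q := q) a b s
  have hT₁ := (hκ.mul (hP₁.const_mul (√(cA k a) : ℂ))).div_const (√(vel k (normSqSub a b)) : ℂ)
  have hT₂ := (hκ.mul (hP₂.const_mul (√(cB k b) : ℂ))).div_const (√(vel k (normSqSub a b)) : ℂ)
  refine ⟨_, _, hT₁.congr_of_eventuallyEq (.of_forall fun r => ?_),
    hT₂.congr_of_eventuallyEq (.of_forall fun r => ?_), ?_⟩
  · simp only [twist₁, cA_leafCurve₁, normSqSub_leafCurve₁, Pi.mul_apply]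
  · simp only [twist₂, cB_leafCurve₁, normSqSub_leafCurve₁, Pi.mul_apply]
  have hw := re_disc_mul_wronskian hkpq _ _ (hs s)
  have hph := halfPhase_sq_mul hC
  have hCn := (norm_disc_pos hk (hs s)).ne'
  rw [cA_leafCurve₁, cB_leafCurve₁] at hw
  simp only [twist₁, twist₂, cA_leafCurve₁, cB_leafCurve₁, normSqSub_leafCurve₁]
  push_cast at hw
  generalize disc k (leafCurve₁ p a s) (leafCurve₁ q b s) = C at *
  generalize pre₁ k (leafCurve₁ p a s) (leafCurve₁ q b s) = P₁ at *
  generalize pre₂ k (leafCurve₁ p a s) (leafCurve₁ q b s) = P₂ at *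
  generalize leafCurve₁ p a s = A at *
  generalize leafCurve₁ q b s = B at *
  rw [← hph] at hw
  set Y := P₁ * (Complex.I * (q * (cA k a * B) + (q + 2 * p) * (k * conj (A * B) * conj A)))
    - P₂ * (Complex.I * (p * (cB k b * A) - (p + 2 * q) * (k * conj (A * B) * conj B))) with hY
  have hw' : ((halfPhase C) ^ 2 * Y).re = 0 := by
    rw [mul_right_comm, Complex.re_mul_ofReal] at hw
    exact (mul_eq_zero.1 hw).resolve_right hCn
  have : ∀ Z : ℂ,
      Z = ((√(cA k a) * √(cB k b) / (√(vel k (normSqSub a b)) * √(vel k (normSqSub a b))) : ℝ)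
      : ℂ) * (halfPhase C ^ 2 * Y) → Z.re = 0 := fun Z hZ => by
    rw [hZ, Complex.re_ofReal_mul, hw', mul_zero]
  apply this
  rw [hY]
  push_cast
  ring

end

/-! ### The image of a leaf is an orbit -/

/-- The potential is even in the real part. -/
theorem fderiv_potential_one {k : ℝ} {W : ℂ} (hk : |k| < 1 / 2) (hW : Complex.normSq W ≤ 1)
    (h0 : W.re = 0) : fderiv ℝ (potential k) W 1 = 0 := by
  have hp : HasFDerivAt (potential k) (fderiv ℝ (potential k) W) W :=
    ((contDiffAt_potential hk hW).differentiableAt (by simp)).hasFDerivAt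
  have hline : HasDerivAt (fun s : ℝ => W + s • (1 : ℂ)) 1 0 := by
    simpa using ((hasDerivAt_id (0 : ℝ)).smul_const (1 : ℂ)).const_add W
  have h1 : HasDerivAt (fun s : ℝ => potential k (W + s • (1 : ℂ)))
      (fderiv ℝ (potential k) W 1) 0 :=
    HasFDerivAt.comp_hasDerivAt (l := potential k) (f := fun s : ℝ => W + s • (1 : ℂ)) 0
      (by simpa using hp) hline
  have h2 : HasDerivAt (fun s : ℝ => potential k (W + (-s) • (1 : ℂ)))
      (-fderiv ℝ (potential k) W 1) 0 := by
    have := HasDerivAt.scomp (g₁ := fun s : ℝ => potential k (W + s • (1 : ℂ))) (0 : ℝ)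
      (by simpa using h1) (hasDerivAt_neg (0 : ℝ))
    exact this.congr_deriv (by simp)
  have h3 : (fun s : ℝ => potential k (W + (-s) • (1 : ℂ)))
      = fun s : ℝ => potential k (W + s • (1 : ℂ)) := by
    funext s
    simp [potential, h0]
  rw [h3] at h2
  linarith [h1.unique h2]

theorem moveMap_one (k : ℝ) (z : R4) : moveMap k 1 z = rot 0 (1 / √2) (twist k z) := by
  simp [moveMap, moveParam]

theorem hasDerivAt_ofPair {f g : ℝ → ℂ} {f' g' : ℂ} {s : ℝ} (hf : HasDerivAt f f' s)
    (hg : HasDerivAt g g' s) : HasDerivAt (fun s => ofPair (f s) (g s)) (ofPair f' g') s :=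
  ofPairL.hasFDerivAt.comp_hasDerivAt s (hf.prodMk hg)

theorem hasDerivAt_z₁ {f : ℝ → R4} {v : R4} {s : ℝ} (hf : HasDerivAt f v s) :
    HasDerivAt (fun s => z₁ (f s)) (z₁ v) s :=
  z₁L.hasFDerivAt.comp_hasDerivAt s hf

theorem hasDerivAt_z₂ {f : ℝ → R4} {v : R4} {s : ℝ} (hf : HasDerivAt f v s) :
    HasDerivAt (fun s => z₂ (f s)) (z₂ v) s :=
  z₂L.hasFDerivAt.comp_hasDerivAt s hf

theorem hasDerivAt_rot {σ : ℝ} {f : ℝ → R4} {v : R4} {s : ℝ} (hf : HasDerivAt f v s) :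
    HasDerivAt (fun s => rot 0 σ (f s)) (rot 0 σ v) s := by
  have h₁ := hasDerivAt_z₁ hf
  have h₂ := hasDerivAt_z₂ hf
  have h₁' := Complex.conjCLE.hasFDerivAt.comp_hasDerivAt s h₁
  have h₂' := Complex.conjCLE.hasFDerivAt.comp_hasDerivAt s h₂
  simp only [rot_zero_left]
  exact hasDerivAt_ofPair (((h₁.const_mul _).sub h₂').const_mul _)
    (((h₂.const_mul _).add h₁').const_mul _)

theorem hasDerivAt_leafCurve (p q : ℕ) (x : S3) (s : ℝ) :
    HasDerivAt (fun s => (leafCurve p q x s : R4))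
      (ofPair (Complex.I * p * leafCurve₁ p (z₁ x) s) (Complex.I * q * leafCurve₁ q (z₂ x) s)) s :=
  hasDerivAt_ofPair (hasDerivAt_leafCurve₁ p _ s) (hasDerivAt_leafCurve₁ q _ s)

theorem contDiff_leafCurve {n : WithTop ℕ∞} (p q : ℕ) (x : S3) :
    ContDiff ℝ n fun s => (leafCurve p q x s : R4) := by
  have h : ∀ (p : ℕ) (a : ℂ), ContDiff ℝ n (leafCurve₁ p a) := fun p a =>
    contDiff_const.mul (contDiff_const.mul contDiff_ofReal).cexp
  exact ofPairL.contDiff.comp ((h p _).prodMk (h q _))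

/-- The image of a leaf under the time-one map of the isotopy. -/
noncomputable def imageCurve (k : ℝ) (p q : ℕ) (x : S3) (s : ℝ) : R4 :=
  moveMap k 1 (leafCurve p q x s)

section

variable {k : ℝ} {p q : ℕ}

theorem contDiff_imageCurve (hk : |k| < 1 / 2) (p q : ℕ) (x : S3) :
    ContDiff ℝ ∞ (imageCurve k p q x) :=
  contDiff_iff_contDiffAt.2 fun s => ContDiffAt.comp s (f := fun s => ((1 : ℝ),
    (leafCurve p q x s : R4))) (contDiffAt_moveMap hk 1 (leafCurve p q x s))
    (contDiffAt_const.prodMk (contDiff_leafCurve p q x).contDiffAt)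

theorem imageCurve_mem (hk : |k| < 1 / 2) (p q : ℕ) (x : S3) (s : ℝ) :
    imageCurve k p q x s ∈ Metric.sphere (0 : R4) 1 := by
  rw [mem_sphere_zero_iff_norm]; exact norm_moveMap hk 1 _

theorem imageCurve_periodic (k : ℝ) (p q : ℕ) (x : S3) :
    Function.Periodic (imageCurve k p q x) (2 * Real.pi) := fun s => by
  rw [imageCurve, leafCurve_periodic]; rfl

theorem hasDerivAt_twist_leafCurve (hk : |k| < 1 / 2) (hkpq : k * (2 * (p + q)) = q - p) (x : S3)
    (s : ℝ) : ∃ v : R4, HasDerivAt (fun s => twist k (leafCurve p q x s)) v s ∧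
      (z₁ (twist k (leafCurve p q x s)) * z₂ v - z₂ (twist k (leafCurve p q x s)) * z₁ v).re
        = 0 := by
  obtain ⟨D₁, D₂, h₁, h₂, h⟩ := hasDerivAt_twist hk hkpq (normSq_add_normSq x) s
  refine ⟨ofPair D₁ D₂, ?_, ?_⟩
  · simpa [twist, leafCurve] using hasDerivAt_ofPair h₁ h₂
  · simpa [twist, leafCurve] using h

/-- The coefficient of the velocity of the image of a leaf in the frame; see `deriv_imageCurve`. -/
noncomputable def frameVel (k : ℝ) (p q : ℕ) (x : S3) (s : ℝ) : ℂ :=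
  z₁ (imageCurve k p q x s) * z₂ (deriv (imageCurve k p q x) s)
    - z₂ (imageCurve k p q x s) * z₁ (deriv (imageCurve k p q x) s)

theorem hasDerivAt_imageCurve (hk : |k| < 1 / 2) (p q : ℕ) (x : S3) (s : ℝ) :
    HasDerivAt (imageCurve k p q x) (deriv (imageCurve k p q x) s) s :=
  ((contDiff_imageCurve hk p q x).differentiable (by simp) s).hasDerivAt

theorem continuous_deriv_imageCurve (hk : |k| < 1 / 2) (p q : ℕ) (x : S3) :
    Continuous (deriv (imageCurve k p q x)) :=
  (contDiff_imageCurve hk p q x).continuous_deriv (by simp)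

theorem deriv_imageCurve (hk : |k| < 1 / 2) (hkpq : k * (2 * (p + q)) = q - p) (x : S3) (s : ℝ) :
    deriv (imageCurve k p q x) s = frame (imageCurve k p q x s) (frameVel k p q x s) := by
  have h1 : inner ℝ (imageCurve k p q x s) (deriv (imageCurve k p q x) s) = (0 : ℝ) := by
    have hd := hasDerivAt_imageCurve hk p q x s
    have h := (hd.inner ℝ hd).unique
      ((hasDerivAt_const s (1 : ℝ)).congr_of_eventuallyEq (.of_forall fun r => by
        simp only [real_inner_self_eq_norm_sq]
        rw [mem_sphere_zero_iff_norm.1 (imageCurve_mem hk p q x r)]; norm_num))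
    rw [real_inner_comm (imageCurve k p q x s)] at h
    linarith
  have h2 : stdContactForm (imageCurve k p q x s) (deriv (imageCurve k p q x) s) = 0 := by
    obtain ⟨v, hv, hre⟩ := hasDerivAt_twist_leafCurve hk hkpq x s
    have hd : HasDerivAt (imageCurve k p q x) (rot 0 (1 / √2) v) s := by
      unfold imageCurve
      simp only [moveMap_one]
      exact hasDerivAt_rot hv
    rw [hd.deriv, imageCurve, moveMap_one, stdContactForm_rot, hre, mul_zero]
  exact eq_frame (y := ⟨_, imageCurve_mem hk p q x s⟩) h1 h2

/-- The image of a leaf is immersed, because the leaf is and `moveInv` is differentiable. -/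
theorem frameVel_ne_zero (hk : |k| < 1 / 2) (hkpq : k * (2 * (p + q)) = q - p) (hp : 1 ≤ p)
    (hq : 1 ≤ q) (x : S3) (s : ℝ) : frameVel k p q x s ≠ 0 := by
  intro h0
  have hd := hasDerivAt_imageCurve hk p q x s
  rw [deriv_imageCurve hk hkpq, h0] at hd
  have hinv := ((contDiffAt_moveInv hk 1 (leafCurve p q x s)).differentiableAt
    (by simp)).hasFDerivAt
  have h1 := hinv.comp_hasDerivAt s hd
  have h2 : moveInv k 1 ∘ imageCurve k p q x = fun s => (leafCurve p q x s : R4) :=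
    funext fun s => moveInv_moveMap hk 1 _
  rw [h2] at h1
  have h3 := h1.unique (hasDerivAt_leafCurve p q x s)
  rw [show frame (imageCurve k p q x s) 0 = 0 by apply ext_z <;> simp [frame] <;> rfl, map_zero]
    at h3
  have e1 := congrArg z₁ h3
  have e2 := congrArg z₂ h3
  have hp0 : (p : ℂ) ≠ 0 := by exact_mod_cast (by omega : p ≠ 0)
  have hq0 : (q : ℂ) ≠ 0 := by exact_mod_cast (by omega : q ≠ 0)
  rw [z₁_ofPair, show z₁ (0 : R4) = 0 from rfl] at e1
  rw [z₂_ofPair, show z₂ (0 : R4) = 0 from rfl] at e2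
  have a1 : leafCurve₁ p (z₁ x) s = 0 := by simpa [hp0] using e1.symm
  have a2 : leafCurve₁ q (z₂ x) s = 0 := by simpa [hq0] using e2.symm
  have := normSq_leafCurve₁_add (p := p) (q := q) (normSq_add_normSq x) s
  simp [a1, a2] at this

end

section

variable {k : ℝ} {p q : ℕ}

/-- The potential is constant along the image of a leaf. -/
theorem potential_imageCurve (hk : |k| < 1 / 2) (p q : ℕ) (x : S3) (s : ℝ) :
    potential k (2 * (z₁ (imageCurve k p q x s) * z₂ (imageCurve k p q x s)))
      = normSqSub (z₁ x) (z₂ x) := by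
  have h := normSq_leafCurve₁_add (p := p) (q := q) (normSq_add_normSq x) s
  rw [imageCurve, moveMap_one, potential_rot]
  · simp only [twist, leafCurve, z₁_ofPair, z₂_ofPair]
    rw [level_twist hk h, normSqSub_leafCurve₁]
  · simp only [twist, leafCurve, z₁_ofPair, z₂_ofPair]
    exact normSq_twist_add hk h

theorem im_mul_conj_symplGrad (k : ℝ) (W Γ : ℂ) :
    (Γ * conj (symplGrad k W)).im = -fderiv ℝ (potential k) W Γ := by
  have h : fderiv ℝ (potential k) W Γ = Γ.re * fderiv ℝ (potential k) W 1
      + Γ.im * fderiv ℝ (potential k) W Complex.I := by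
    conv_lhs => rw [show Γ = Γ.re • (1 : ℂ) + Γ.im • Complex.I by
      simp [Complex.re_add_im], map_add, map_smul, map_smul]
    simp
  rw [h]
  simp [symplGrad]
  ring

/-- Along the image of a leaf, `W = 2 z₁ z₂` has the derivative `2 (|z₁|² - |z₂|²)` times
`frameVel`, and the potential of `W` does not change. -/
theorem normSqSub_mul_fderiv_potential (hk : |k| < 1 / 2) (hkpq : k * (2 * (p + q)) = q - p) (x : S3)
    (s : ℝ) : normSqSub (z₁ (imageCurve k p q x s)) (z₂ (imageCurve k p q x s)) *
      fderiv ℝ (potential k) (2 * (z₁ (imageCurve k p q x s) * z₂ (imageCurve k p q x s)))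
        (frameVel k p q x s) = 0 := by
  have hd := hasDerivAt_imageCurve hk p q x s
  have h₁ := hasDerivAt_z₁ hd
  have h₂ := hasDerivAt_z₂ hd
  have hW := (h₁.mul h₂).const_mul 2
  have hpot := ((contDiffAt_potential hk (normSq_two_mul_le
    ⟨_, imageCurve_mem hk p q x s⟩)).differentiableAt (by simp)).hasFDerivAt
  have h := HasFDerivAt.comp_hasDerivAt (l := potential k) s hpot hW
  have h0 := h.unique ((hasDerivAt_const s (normSqSub (z₁ x) (z₂ x))).congr_of_eventuallyEq
    (.of_forall fun r => potential_imageCurve hk p q x r))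
  have e : 2 * (z₁ (deriv (imageCurve k p q x) s) * z₂ (imageCurve k p q x s)
      + z₁ (imageCurve k p q x s) * z₂ (deriv (imageCurve k p q x) s))
      = (2 * normSqSub (z₁ (imageCurve k p q x s)) (z₂ (imageCurve k p q x s)))
        • frameVel k p q x s := by
    rw [deriv_imageCurve hk hkpq]
    simp only [frame, z₁_ofPair, z₂_ofPair, normSqSub, Complex.real_smul]
    push_cast
    rw [← Complex.mul_conj, ← Complex.mul_conj]
    ring
  rw [e, map_smul, smul_eq_mul] at h0
  linarith

theorem normSqSub_imageCurve (k : ℝ) (p q : ℕ) (x : S3) (s : ℝ) :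
    normSqSub (z₁ (imageCurve k p q x s)) (z₂ (imageCurve k p q x s))
      = 2 * (z₁ (twist k (leafCurve p q x s)) * z₂ (twist k (leafCurve p q x s))).im := by
  rw [imageCurve, moveMap_one, normSqSub_rot]

theorem twist₁_zero_left (k : ℝ) (b : ℂ) : twist₁ k 0 b = 0 := by simp [twist₁, pre₁]

theorem twist₂_zero_right (k : ℝ) (a : ℂ) : twist₂ k a 0 = 0 := by simp [twist₂, pre₂]

theorem frame_ofReal_mul (y : R4) (r : ℝ) (G : ℂ) : frame y (r * G) = r • frame y G := by
  have h : ∀ a b : ℂ, ofPair (r • a) (r • b) = r • ofPair a b := fun a b => ofPairL.map_smul r (a, b)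
  rw [frame, frame, ← h, Complex.real_smul, Complex.real_smul]
  congr 1 <;> ring

/-- On the two exceptional leaves, where one coordinate vanishes, `W` does not move; instead, `W` is
purely imaginary and `frameVel` is real there. -/
theorem fderiv_potential_frameVel_of_eq_zero (hk : |k| < 1 / 2)
    (hkpq : k * (2 * (p + q)) = q - p) (x : S3) (hx : z₁ x * z₂ x = 0) (s : ℝ) :
    fderiv ℝ (potential k) (2 * (z₁ (imageCurve k p q x s) * z₂ (imageCurve k p q x s)))
        (frameVel k p q x s) = 0 := by
  have hz : (∀ s, z₁ (twist k (leafCurve p q x s)) = 0) ∨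
      (∀ s, z₂ (twist k (leafCurve p q x s)) = 0) := by
    rcases mul_eq_zero.1 hx with h | h
    · left; intro s; simp [twist, leafCurve, h, leafCurve₁, twist₁_zero_left]
    · right; intro s; simp [twist, leafCurve, h, leafCurve₁, twist₂_zero_right]
  obtain ⟨v, hv, -⟩ := hasDerivAt_twist_leafCurve hk hkpq x s
  have hd : HasDerivAt (imageCurve k p q x) (rot 0 (1 / √2) v) s := by
    unfold imageCurve
    simp only [moveMap_one]
    exact hasDerivAt_rot hv
  have hre : (2 * (z₁ (imageCurve k p q x s) * z₂ (imageCurve k p q x s))).re = 0 := by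
    rw [imageCurve, moveMap_one, two_mul_rot]
    rcases hz with h | h <;> simp [h s]
  have him : (frameVel k p q x s).im = 0 := by
    rw [frameVel, hd.deriv, imageCurve, moveMap_one, wronskian_rot_im]
    rcases hz with h | h
    · have h' := (hasDerivAt_z₁ hv).unique
        ((hasDerivAt_const s (0 : ℂ)).congr_of_eventuallyEq (.of_forall h))
      simp [h s, h']
    · have h' := (hasDerivAt_z₂ hv).unique
        ((hasDerivAt_const s (0 : ℂ)).congr_of_eventuallyEq (.of_forall h))
      simp [h s, h']
  have hΓ : frameVel k p q x s = (frameVel k p q x s).re • (1 : ℂ) := by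
    apply Complex.ext <;> simp [him]
  rw [hΓ, map_smul, fderiv_potential_one hk
    (normSq_two_mul_le ⟨_, imageCurve_mem hk p q x s⟩) hre, smul_zero]

/-- The velocity `frameVel` is tangent to the level curves of the potential. This is clear where
`|z₁|² ≠ |z₂|²` on the image curve. If it failed at `s`, then `|z₁|² = |z₂|²` would hold near `s`,
so that `Im (z₁ z₂)` would vanish near `s` on the leaf, as would its derivative, a multiple of
`Re (z₁ z₂)`. -/
theorem fderiv_potential_frameVel (hk : |k| < 1 / 2) (hkpq : k * (2 * (p + q)) = q - p)
    (hp : 1 ≤ p) (x : S3) (s : ℝ) :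
    fderiv ℝ (potential k) (2 * (z₁ (imageCurve k p q x s) * z₂ (imageCurve k p q x s)))
        (frameVel k p q x s) = 0 := by
  by_cases hx : z₁ x * z₂ x = 0
  · exact fderiv_potential_frameVel_of_eq_zero hk hkpq x hx s
  by_contra hne
  have hci : Continuous (imageCurve k p q x) := (contDiff_imageCurve hk p q x).continuous
  have hcd := continuous_deriv_imageCurve hk p q x
  have hcW : Continuous fun s => 2 * (z₁ (imageCurve k p q x s) * z₂ (imageCurve k p q x s)) :=
    continuous_const.mul ((continuous_z₁.comp hci).mul (continuous_z₂.comp hci))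
  have hcΓ : Continuous (frameVel k p q x) :=
    ((continuous_z₁.comp hci).mul (continuous_z₂.comp hcd)).sub
      ((continuous_z₂.comp hci).mul (continuous_z₁.comp hcd))
  have hcont : ContinuousAt (fun s => fderiv ℝ (potential k)
      (2 * (z₁ (imageCurve k p q x s) * z₂ (imageCurve k p q x s))) (frameVel k p q x s)) s := by
    have h1 : ContinuousAt (fderiv ℝ (potential k))
        (2 * (z₁ (imageCurve k p q x s) * z₂ (imageCurve k p q x s))) :=
      ((contDiffAt_potential hk (normSq_two_mul_le
        ⟨_, imageCurve_mem hk p q x s⟩)).fderiv_right (m := 0) (by simp)).continuousAt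
    exact (ContinuousAt.comp (f := fun s => 2 * (z₁ (imageCurve k p q x s) *
      z₂ (imageCurve k p q x s))) h1 hcW.continuousAt).clm_apply hcΓ.continuousAt
  have hev : ∀ᶠ r in nhds s, (leafCurve₁ p (z₁ x) r * leafCurve₁ q (z₂ x) r).im = 0 := by
    filter_upwards [hcont.eventually_ne hne] with r hr
    have h1 := (mul_eq_zero.1 (normSqSub_mul_fderiv_potential hk hkpq x r)).resolve_right hr
    rw [normSqSub_imageCurve] at h1
    have hs := normSq_leafCurve₁_add (p := p) (q := q) (normSq_add_normSq x) r
    have h2 := twist_mul_im hk hs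
    simp only [twist, leafCurve, z₁_ofPair, z₂_ofPair] at h1
    rw [(mul_eq_zero.1 h1).resolve_left two_ne_zero, zero_mul] at h2
    refine (mul_eq_zero.1 h2.symm).resolve_left ?_
    exact (Real.sqrt_pos.2 (mul_pos (cA_pos hk hs) (cB_pos hk hs))).ne'
  have hd := Complex.imCLM.hasFDerivAt.comp_hasDerivAt s
    ((hasDerivAt_leafCurve₁ p (z₁ x) s).mul (hasDerivAt_leafCurve₁ q (z₂ x) s))
  have h1 := hd.unique ((hasDerivAt_const s (0 : ℝ)).congr_of_eventuallyEq hev)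
  have h2 : ((p + q : ℝ) * (leafCurve₁ p (z₁ x) s * leafCurve₁ q (z₂ x) s).re) = 0 := by
    rw [← h1]
    simp
    ring
  have hpq : (p + q : ℝ) ≠ 0 := by positivity
  have h3 : leafCurve₁ p (z₁ x) s * leafCurve₁ q (z₂ x) s = 0 :=
    Complex.ext ((mul_eq_zero.1 h2).resolve_left hpq) hev.self_of_nhds
  simp only [leafCurve₁, mul_eq_zero, Complex.exp_ne_zero, or_false] at h3
  exact hx (mul_eq_zero.2 h3)

/-- `frameVel` and `symplGrad` both span the kernel of the derivative of the potential. -/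
theorem exists_deriv_imageCurve_eq_smul (hk : |k| < 1 / 2) (hkpq : k * (2 * (p + q)) = q - p)
    (hp : 1 ≤ p) (hq : 1 ≤ q) (x : S3) (s : ℝ) : ∃ r : ℝ, r ≠ 0 ∧
      deriv (imageCurve k p q x) s = r • ambientField k (imageCurve k p q x s) := by
  have hG := symplGrad_ne_zero hk (normSq_two_mul_le ⟨_, imageCurve_mem hk p q x s⟩)
  have him := im_mul_conj_symplGrad k
    (2 * (z₁ (imageCurve k p q x s) * z₂ (imageCurve k p q x s))) (frameVel k p q x s)
  rw [fderiv_potential_frameVel hk hkpq hp, neg_zero] at him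
  have hΓ := frameVel_ne_zero hk hkpq hp hq x s
  have hd := deriv_imageCurve hk hkpq x s
  rw [ambientField]
  simp only at hG
  generalize symplGrad k (2 * (z₁ (imageCurve k p q x s) * z₂ (imageCurve k p q x s))) = G at *
  generalize frameVel k p q x s = Γ at *
  have e : (((Γ * conj G).re / Complex.normSq G : ℝ) : ℂ) * G = Γ := by
    have h1 : (((Γ * conj G).re : ℝ) : ℂ) = Γ * conj G := Complex.ext (by simp) (by simp [him])
    have h2 : (Complex.normSq G : ℂ) ≠ 0 := by simpa using hG
    push_cast
    rw [h1, div_mul_eq_mul_div, div_eq_iff h2, ← Complex.mul_conj]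
    ring
  refine ⟨(Γ * conj G).re / Complex.normSq G, fun h0 => hΓ ?_, ?_⟩
  · rw [← e, h0]; simp
  · rw [hd]
    conv_lhs => rw [← e]
    rw [frame_ofReal_mul]

theorem move_image_seifertLeaf (hk : |k| < 1 / 2) (hkpq : k * (2 * (p + q)) = q - p)
    (hp : 1 ≤ p) (hq : 1 ≤ q) (x : S3) :
    move hk 1 '' seifertLeaf p q x = orbit (field k) (move hk 1 x) := by
  set c : ℝ → S3 := fun s => move hk 1 (leafCurve p q x s) with hc
  have hcc : ∀ s, (c s : R4) = imageCurve k p q x s := fun s => rfl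
  choose g hg0 hg using exists_deriv_imageCurve_eq_smul hk hkpq hp hq x
  have hv : ∀ s, field k (c s) ≠ 0 := fun s => field_ne_zero hk _
  have hgeq : ∀ s, g s = inner ℝ (field k (c s)) (deriv (imageCurve k p q x) s)
      / ‖field k (c s)‖ ^ 2 := fun s => by
    rw [hg s]
    change g s = inner ℝ (field k (c s)) (g s • field k (c s)) / _
    rw [real_inner_smul_right, real_inner_self_eq_norm_sq, mul_div_assoc, div_self, mul_one]
    exact pow_ne_zero 2 (norm_ne_zero_iff.2 (hv s))
  have hper : Function.Periodic c (2 * Real.pi) := fun s => by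
    simp only [hc]; rw [leafCurve_periodic]
  have hci : Continuous (imageCurve k p q x) := (contDiff_imageCurve hk p q x).continuous
  have hcf : Continuous fun s => field k (c s) := continuous_iff_continuousAt.2 fun s =>
    ContinuousAt.comp (f := imageCurve k p q x) (contDiffAt_ambientField hk (c s)).continuousAt
      hci.continuousAt
  have hgc : Continuous g := by
    rw [funext hgeq]
    exact (hcf.inner (continuous_deriv_imageCurve hk p q x)).div (hcf.norm.pow 2)
      fun s => pow_ne_zero 2 (norm_ne_zero_iff.2 (hv s))
  have hdper : Function.Periodic (deriv (imageCurve k p q x)) (2 * Real.pi) := fun s => by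
    rw [← deriv_comp_add_const]
    congr 1
    exact funext (imageCurve_periodic k p q x)
  have hgper : Function.Periodic g (2 * Real.pi) := fun s => by
    rw [hgeq, hgeq, hdper, hper]
  have horb := orbit_eq_range (X := field k) (F := ambientField k) (c := c) (fun _ => rfl)
    (fun y => (contDiffAt_ambientField hk y).of_le (by simp)) hgc hg0 Real.two_pi_pos hgper
    (fun s => (hasDerivAt_imageCurve hk p q x s).congr_deriv (hg s))
  rw [seifertLeaf_eq_range, ← Set.range_comp]
  refine Eq.trans ?_ (horb.symm.trans ?_)
  · rfl
  · rw [hc]; simp only [leafCurve_zero]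

end

end SeifertLegendrian

open SeifertLegendrian in
theorem proposition1p6 (p q : ℕ) (hp : 1 ≤ p) (hq : 1 ≤ q) :
    ∃ X : S3 → R4,
      IsTangentField X ∧
      (∀ x : S3, X x ≠ 0) ∧
      IsAnalyticField X ∧
      (∀ x : S3, divergence X x = 0) ∧
      IsLegendrian X ∧
      AreIsotopic (seifertLeaf p q) (orbit X) := by
  have hp' : (1 : ℝ) ≤ p := by exact_mod_cast hp
  have hq' : (1 : ℝ) ≤ q := by exact_mod_cast hq
  obtain ⟨k, hk⟩ : ∃ k : ℝ, k = (q - p) / (2 * (p + q)) := ⟨_, rfl⟩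
  have hkpq : k * (2 * (p + q)) = q - p := by rw [hk]; field_simp
  have hk2 : |k| < 1 / 2 := by
    rw [hk, abs_div, abs_of_pos (by positivity : (0 : ℝ) < 2 * (p + q)),
      div_lt_iff₀ (by positivity), abs_lt]
    constructor <;> linarith
  exact ⟨field k, isTangentField_field k, field_ne_zero hk2, isAnalyticField_field hk2,
    divergence_field hk2, isLegendrian_field k, move hk2, isIsotopy_move hk2,
    move_image_seifertLeaf hk2 hkpq hp hq⟩
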